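/- Let $n\ge 2$ and let $(z,w)=(z_1,\dots,z_n,w)$ be the coordinates of $\mathbb C^{n}\times\mathbb C$. For a formal power series $f(z,\bar z)=\sum a_{PQ}z^P\bar z^Q$ with complex coefficients put $\overline{f}(z,\bar z)=\sum \overline{a_{PQ}}\,\bar z^P z^Q$; $f$ is called real-valued if $\overline f=f$. A formal change of coordinates of $\mathbb C^{n+1}$ is a tuple $H=(F,G)=(F_1,\dots,F_n,G)$ of formal power series in $(z,w)$ with $H(0)=0$ and with invertible Jacobian matrix at $0$. If $\Phi(z,\bar z)$ has no constant term, $H$ maps the formal submanifold $w=\Phi(z,\bar z)$ to the formal submanifold $w'=\Phi'(z',\bar z')$ if $$G(z,\Phi(z,\bar z))=\Phi'\bigl(F(z,\Phi(z,\bar z)),\overline{F(z,\Phi(z,\bar z))}\bigr)$$ as formal power series in $(z,\bar z)$. The two submanifolds are formally equivalent if some formal change of coordinates maps the first to the second. A formal submanifold can be formally flattened if it is formally equivalent to some $w'=E^*(z',\bar z')$ with $E^*$ real-valued. Put $u=|z|^2=\sum_{i=1}^n|z_i|^2$ and $v_k=\sum_{i=1}^{k-1}|z_i|^2-|z_k|^2$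 for $2\le k\le n$. Every formal power series $\varphi(z,\bar z)$ has a unique expansion $$\varphi=\sum \varphi_{(I,J)}^{(K)}\,z^I\bar z^J u^{k_1}v_2^{k_2}\cdots v_n^{k_n},$$ the sum being over all multi-indices $I,J,K\in\mathbb Z_{\ge0}^n$ with $i_kj_k=0$ for $1\le k\le n$. Let $e_j$ be the $j$-th unit multi-index. Call $\varphi$ normalized if $\varphi=O(|z|^3)$ and, for all integers $k\ge0$, $l\ge1$, $\tau\ge2$, 1. $\varphi_{(0,0)}^{(\tau e_1)}=0$; 2. $\operatorname{Re}\varphi_{(0,0)}^{(le_1+e_i)}=0$ for $2\le i\le n$; 3. $\varphi_{(e_i,e_j)}^{(le_1)}=0$ for $i>j$; 4. $\varphi_{(I,0)}^{(le_1)}=\varphi_{(0,I)}^{(le_1)}=\varphi_{(0,I)}^{(ke_1+e_j)}=0$ for $|I|\ge1$ and $1\le j\le n$; 5. $\varphi_{(I,e_h)}^{(ke_1)}=0$ for $1\le h\le n$ and $|I|\ge2$ with $i_h=0$; 6. $\varphi_{(0,I)}^{(0)}=\overline{\varphi_{(I,0)}^{(0)}}$ for $|I|>2$. A pseudo-normal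 form of a formal submanifold $M$ is a formal submanifold $w'=|z'|^2+\varphi(z',\bar z')$ that is formally equivalent to $M$, with $\varphi$ normalized; it is flat if $\varphi$ is real-valued. **Theorem.** Let $M$ be the formal submanifold $w=|z|^2+E(z,\bar z)$, where $E$ is a formal power series in $(z,\bar z)$ with $E=O(|z|^3)$. Then the following are equivalent. (I) $(M,0)$ can be formally flattened. (II) $(M,0)$ has a flat pseudo-normal form. (III) Every pseudo-normal form of $(M,0)$ is flat. -/

import Mathlib

namespace CRSingular

noncomputable section

/-- Formal power series in `(z, z̄)`, `z = (z_1, …, z_n)`, with complex coefficients. The variable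
`Sum.inl k` is `z_k` and the variable `Sum.inr k` is `z̄_k`. -/
abbrev RealSeries (n : ℕ) : Type := MvPowerSeries (Fin n ⊕ Fin n) ℂ

/-- Formal power series in `(z, w)`, `z = (z_1, …, z_n)`. The variable `Sum.inl k` is `z_k` and the
variable `Sum.inr ()` is `w`. -/
abbrev HolSeries (n : ℕ) : Type := MvPowerSeries (Fin n ⊕ Unit) ℂ

variable {n : ℕ}

/-- The variable `z_k`. -/
def zVar (k : Fin n) : RealSeries n := MvPowerSeries.X (Sum.inl k)

/-- The variable `z̄_k`. -/
def zbarVar (k : Fin n) : RealSeries n := MvPowerSeries.X (Sum.inr k)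

/-- Complex conjugation of a formal power series in `(z, z̄)`: the coefficient of `z^P z̄^Q` in
the conjugate of `f` is the complex conjugate of the coefficient of `z^Q z̄^P` in `f`. -/
def conj (f : RealSeries n) : RealSeries n :=
  fun m => starRingEnd ℂ (MvPowerSeries.coeff (Finsupp.mapDomain Sum.swap m) f)

/-- `f(z, z̄)` is formally real-valued. -/
def IsRealValued (f : RealSeries n) : Prop := conj f = f

/-- `|z_k|² = z_k z̄_k`. -/
def absSq (k : Fin n) : RealSeries n := zVar k * zbarVar k

/-- `|z|² = ∑ |z_k|²`. -/
def normSq (n : ℕ) : RealSeries n := ∑ k : Fin n, absSq k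

/-! ### Formal changes of coordinates and formal submanifolds -/

/-- A formal self-map `H = (F, G)` of `ℂⁿ⁺¹`: `H (Sum.inl k) = F_k(z, w)` and
`H (Sum.inr ()) = G(z, w)`. -/
abbrev FormalMap (n : ℕ) : Type := Fin n ⊕ Unit → HolSeries n

/-- `H` is a formal change of coordinates with `H(0) = 0`: there are no constant terms, and the
Jacobian matrix at `0` is invertible. -/
def IsFormalChange (H : FormalMap n) : Prop :=
  (∀ a, MvPowerSeries.constantCoeff (H a) = 0) ∧
    IsUnit (Matrix.det (Matrix.of fun a b : Fin n ⊕ Unit =>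
      MvPowerSeries.coeff (Finsupp.single b 1) (H a)))

/-- The substitution of `w = Φ(z, z̄)` in a formal power series in `(z, w)`; it is meaningful when
`Φ` has no constant term. -/
def restrict (Φ : RealSeries n) (h : HolSeries n) : RealSeries n :=
  MvPowerSeries.subst (Sum.elim zVar (fun _ => Φ)) h

/-- `H = (F, G)` maps the formal submanifold `w = Φ(z, z̄)` to the formal submanifold
`w' = Φ'(z', z̄')`, that is, `G = Φ'(F, F̄)` holds on `w = Φ(z, z̄)`. -/
def MapsGraph (H : FormalMap n) (Φ Φ' : RealSeries n) : Prop :=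
  restrict Φ (H (Sum.inr ())) =
    MvPowerSeries.subst
      (Sum.elim (fun k => restrict Φ (H (Sum.inl k)))
        (fun k => conj (restrict Φ (H (Sum.inl k))))) Φ'

/-- The germs at `0` of the formal submanifolds `w = Φ(z, z̄)` and `w' = Φ'(z', z̄')` are formally
equivalent. -/
def FormallyEquivalent (Φ Φ' : RealSeries n) : Prop :=
  ∃ H : FormalMap n, IsFormalChange H ∧ MapsGraph H Φ Φ'

/-- The formal submanifold `w = Φ(z, z̄)` can be formally flattened: in suitable formal coordinates
it is given by `w' = E*(z', z̄')` with `E*` formally real-valued. -/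
def CanBeFlattened (Φ : RealSeries n) : Prop :=
  ∃ Estar : RealSeries n, IsRealValued Estar ∧ FormallyEquivalent Φ Estar

/-! ### The expansion in `z^I z̄^J u^{k_1} v_2^{k_2} ⋯ v_n^{k_n}` -/

/-- The series `u, v_2, …, v_n`. The index `0 : Fin n` stands for `1` in the usual numbering and
gives `u = |z|²`; any other index `k` gives `v_k = ∑_{i < k} |z_i|² - |z_k|²`. -/
def uv (k : Fin n) : RealSeries n :=
  if (k : ℕ) = 0 then normSq n else (∑ i ∈ Finset.univ.filter (· < k), absSq i) - absSq k

/-- The term `z^I z̄^J u^{k_1} v_2^{k_2} ⋯ v_n^{k_n}`. -/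
def expTerm (I J K : Fin n →₀ ℕ) : RealSeries n :=
  (∏ k, zVar k ^ I k) * (∏ k, zbarVar k ^ J k) * ∏ k, uv k ^ K k

/-- The triples of multi-indices `(I, J, K)` with `i_k j_k = 0` for all `k`. -/
abbrev ExpIndex (n : ℕ) : Type :=
  {p : (Fin n →₀ ℕ) × (Fin n →₀ ℕ) × (Fin n →₀ ℕ) // ∀ k, p.1 k * p.2.1 k = 0}

open scoped MvPowerSeries.WithPiTopology in
/-- The numbers `c I J K = φ_{(I,J)}^{(K)}` are the coefficients of the expansion
`φ = ∑ φ_{(I,J)}^{(K)} z^I z̄^J u^{k_1} v_2^{k_2} ⋯ v_n^{k_n}` over all `(I, J, K)` with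
`i_k j_k = 0` for all `k`. The sum is a sum of formal power series, coefficient by coefficient; in
each degree only finitely many terms contribute. The values of `c` at other triples play no
role. -/
def IsExpansion (φ : RealSeries n) (c : (Fin n →₀ ℕ) → (Fin n →₀ ℕ) → (Fin n →₀ ℕ) → ℂ) : Prop :=
  HasSum (fun p : ExpIndex n => c p.1.1 p.1.2.1 p.1.2.2 • expTerm p.1.1 p.1.2.1 p.1.2.2) φ

/-- The multi-index `e_j`. -/
abbrev e (j : Fin n) : Fin n →₀ ℕ := Finsupp.single j 1

/-- The normalization conditions on the coefficients `c I J K = φ_{(I,J)}^{(K)}`. The index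
`0 : Fin n` stands for `1` in the usual numbering, so `l • e 0` is `l e_1`. -/
structure NormalizedCoeffs [NeZero n]
    (c : (Fin n →₀ ℕ) → (Fin n →₀ ℕ) → (Fin n →₀ ℕ) → ℂ) : Prop where
  pure_u : ∀ τ : ℕ, 2 ≤ τ → c 0 0 (τ • e 0) = 0
  linear_v : ∀ l : ℕ, 1 ≤ l → ∀ i : Fin n, i ≠ 0 → (c 0 0 (l • e 0 + e i)).re = 0
  bilinear : ∀ l : ℕ, 1 ≤ l → ∀ i j : Fin n, j < i → c (e i) (e j) (l • e 0) = 0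
  hol_u : ∀ l : ℕ, 1 ≤ l → ∀ I : Fin n →₀ ℕ, 1 ≤ I.degree → c I 0 (l • e 0) = 0
  antihol_u : ∀ l : ℕ, 1 ≤ l → ∀ I : Fin n →₀ ℕ, 1 ≤ I.degree → c 0 I (l • e 0) = 0
  antihol_v : ∀ (k : ℕ) (j : Fin n) (I : Fin n →₀ ℕ), 1 ≤ I.degree → c 0 I (k • e 0 + e j) = 0
  mixed : ∀ (k : ℕ) (h : Fin n) (I : Fin n →₀ ℕ), 2 ≤ I.degree → I h = 0 →
    c I (e h) (k • e 0) = 0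
  harmonic : ∀ I : Fin n →₀ ℕ, 2 < I.degree → c 0 I 0 = starRingEnd ℂ (c I 0 0)

/-- `φ = O(|z|³)`, and the coefficients of the (unique) expansion of `φ` satisfy the normalization
conditions. -/
def IsNormalized [NeZero n] (φ : RealSeries n) : Prop :=
  3 ≤ φ.order ∧ ∃ c, IsExpansion φ c ∧ NormalizedCoeffs c

/-- `w' = |z'|² + φ(z', z̄')` is a pseudo-normal form of the formal submanifold
`w = |z|² + E(z, z̄)`. -/
def IsPseudoNormalForm [NeZero n] (E φ : RealSeries n) : Prop :=
  IsNormalized φ ∧ FormallyEquivalent (normSq n + E) (normSq n + φ)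

end

end CRSingular

/-! Write `Φ = |z|² + E` for the equation of `M`, and give `z` weight 1 and `w` weight 2. The
implication from (II) to (I) is immediate, since `|z|² + φ` is real-valued when `φ` is. The rest
needs two facts: a pseudo-normal form always exists, and on a flattenable `M` every one is flat.

Existence. For `H = (z + f, w + g)` the mapping equation is `φ = ψ + g(z, u) - 2 Re ∑ z̄_h f_h(z,
u)`, where `ψ` is `E` plus terms of higher order in `f`, `g`, `φ`. For a given `ψ` the coefficients
of `f` and `g` can be chosen explicitly (`solF`, `solG`) so that the right side is normalized
(`normalizedCoeffs_solPhi`). The equation for `ψ` then has the form `ψ = normalizingMap E ψ`. The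
map on its right raises the order of differences by one, so it has a fixed point
(`exists_fixed_point`).

Rigidity. Let `G₁` be the `w`-component of a flattening of `M`; its restriction to `M` is
real-valued. Let `H₂ = (F, G₂)` map `M` to `w = |z|² + φ`, so that on `M` the imaginary part of `G₂`
is that of `φ(F, F̄)`. By induction on `t`, `φ - φ̄` has order at least `t`, and `G₂` agrees with a
real polynomial `P` in `G₁` up to weight `t`. For the step put `Q = G₂ - P`. After the linear change
of `z` that undoes the linear part of `F`, the leading part of `φ - φ̄` becomes `q - q̄` for some
series `q(z, u)`. In such a difference only the terms `z^I u^k` and their conjugates occur, and for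
these the normalization gives `φ - φ̄` the coefficient zero (`mem_orderIdeal_succ_of_normalized`).
So `Q` is real on `M` to leading order. A leading part with this property is a real multiple of some
`w^k`, and a real multiple of `G₁^k` removes it (`exists_sub_mul_pow_mem`). -/

namespace MvPowerSeries

/-! ### Weighted order, substitution and fixed points for formal power series -/

variable {σ τ R : Type*} [CommRing R]

/-- The power series with given coefficients. -/
def ofCoeff (c : (σ →₀ ℕ) → R) : MvPowerSeries σ R := c

@[simp]
theorem coeff_ofCoeff (c : (σ →₀ ℕ) → R) (d : σ →₀ ℕ) : coeff d (ofCoeff c) = c d := rfl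

/-- The ideal of power series of weighted order at least `t`. -/
def orderIdeal (w : σ → ℕ) (t : ℕ) : Ideal (MvPowerSeries σ R) where
  carrier := {f | ∀ d, Finsupp.weight w d < t → coeff d f = 0}
  add_mem' {f g} hf hg d hd := by simp [hf d hd, hg d hd]
  zero_mem' d _ := by simp
  smul_mem' c f hf := by
    have h : (t : ℕ∞) ≤ f.weightedOrder w := nat_le_weightedOrder w hf
    have h2 : (t : ℕ∞) ≤ (c * f).weightedOrder w :=
      (h.trans le_add_self).trans (le_weightedOrder_mul w)
    intro d hd
    exact coeff_eq_zero_of_lt_weightedOrder w (lt_of_lt_of_le (by exact_mod_cast hd) h2)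

theorem mem_orderIdeal {w : σ → ℕ} {t : ℕ} {f : MvPowerSeries σ R} :
    f ∈ orderIdeal w t ↔ ∀ d, Finsupp.weight w d < t → coeff d f = 0 := Iff.rfl

theorem mem_orderIdeal_iff_le {w : σ → ℕ} {t : ℕ} {f : MvPowerSeries σ R} :
    f ∈ orderIdeal w t ↔ (t : ℕ∞) ≤ f.weightedOrder w :=
  ⟨nat_le_weightedOrder w, fun h _ hd =>
    coeff_eq_zero_of_lt_weightedOrder w (lt_of_lt_of_le (by exact_mod_cast hd) h)⟩

theorem mem_orderIdeal_one_iff_le {t : ℕ} {f : MvPowerSeries σ R} :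
    f ∈ orderIdeal 1 t ↔ (t : ℕ∞) ≤ f.order := mem_orderIdeal_iff_le

theorem mem_orderIdeal_one {t : ℕ} {f : MvPowerSeries σ R} :
    f ∈ orderIdeal 1 t ↔ ∀ d : σ →₀ ℕ, d.degree < t → coeff d f = 0 := by
  simp only [mem_orderIdeal, Finsupp.degree_eq_weight_one]; rfl

theorem orderIdeal_mono {w : σ → ℕ} {s t : ℕ} (h : s ≤ t) :
    (orderIdeal w t : Ideal (MvPowerSeries σ R)) ≤ orderIdeal w s :=
  fun _ hf d hd => hf d (hd.trans_le h)

theorem mem_orderIdeal_zero {w : σ → ℕ} (f : MvPowerSeries σ R) : f ∈ orderIdeal w 0 :=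
  fun _ hd => absurd hd (Nat.not_lt_zero _)

theorem mul_mem_orderIdeal {w : σ → ℕ} {s t : ℕ} {f g : MvPowerSeries σ R}
    (hf : f ∈ orderIdeal w s) (hg : g ∈ orderIdeal w t) : f * g ∈ orderIdeal w (s + t) := by
  rw [mem_orderIdeal_iff_le] at *
  push_cast
  exact (add_le_add hf hg).trans (le_weightedOrder_mul w)

theorem mem_orderIdeal_one_one {f : MvPowerSeries σ R} :
    f ∈ orderIdeal 1 1 ↔ constantCoeff f = 0 := by
  rw [mem_orderIdeal_one]
  constructor
  · intro h; simpa using h 0 (by simp)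
  · intro h d hd
    have : d = 0 := by simpa [Finsupp.degree_eq_zero_iff] using hd
    subst this; simpa using h

theorem X_mem_orderIdeal (w : σ → ℕ) (s : σ) : (X s : MvPowerSeries σ R) ∈ orderIdeal w (w s) := by
  classical
  intro d hd
  rw [coeff_X, if_neg]
  rintro rfl
  simp [Finsupp.weight_single] at hd

theorem eq_zero_of_forall_mem_orderIdeal {w : σ → ℕ} {f : MvPowerSeries σ R} (t₀ : ℕ)
    (h : ∀ t, t₀ ≤ t → f ∈ orderIdeal w t) : f = 0 := by
  ext d
  exact h (max t₀ (Finsupp.weight w d + 1)) (le_max_left _ _) d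
    (lt_of_lt_of_le (Nat.lt_succ_self _) (le_max_right _ _))

/-- The three membership claims together are stable under products, by `xx' - yy' = (x - y)x' + y(x'
- y')`. So a gain `e` in each variable passes to every monomial, and from there to every
substitution. -/
theorem prod_pow_sub_prod_pow_mem {w : σ → ℕ} {v : τ → ℕ} {e : ℕ} {a b : σ → MvPowerSeries τ R}
    (ha : ∀ s, a s ∈ orderIdeal v (w s)) (hb : ∀ s, b s ∈ orderIdeal v (w s))
    (hab : ∀ s, a s - b s ∈ orderIdeal v (w s + e)) (d : σ →₀ ℕ) :
    (d.prod fun s k => a s ^ k) ∈ orderIdeal v (Finsupp.weight w d) ∧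
    (d.prod fun s k => b s ^ k) ∈ orderIdeal v (Finsupp.weight w d) ∧
    (d.prod fun s k => a s ^ k) - (d.prod fun s k => b s ^ k) ∈
      orderIdeal v (Finsupp.weight w d + e) := by
  have key : ∀ {m k : ℕ} {x y x' y' : MvPowerSeries τ R},
      x ∈ orderIdeal v m ∧ y ∈ orderIdeal v m ∧ x - y ∈ orderIdeal v (m + e) →
      x' ∈ orderIdeal v k ∧ y' ∈ orderIdeal v k ∧ x' - y' ∈ orderIdeal v (k + e) →
      x * x' ∈ orderIdeal v (m + k) ∧ y * y' ∈ orderIdeal v (m + k) ∧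
        x * x' - y * y' ∈ orderIdeal v (m + k + e) := by
    rintro m k x y x' y' ⟨h1, h2, h3⟩ ⟨h1', h2', h3'⟩
    refine ⟨mul_mem_orderIdeal h1 h1', mul_mem_orderIdeal h2 h2', ?_⟩
    have : x * x' - y * y' = (x - y) * x' + y * (x' - y') := by ring
    rw [this]
    refine add_mem ?_ ?_
    · have := mul_mem_orderIdeal h3 h1'
      rwa [add_right_comm] at this
    · have := mul_mem_orderIdeal h2 h3'
      rwa [← add_assoc] at this
  induction d using Finsupp.induction_linear with
  | zero => simpa using mem_orderIdeal_zero (1 : MvPowerSeries τ R)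
  | add f g hf hg =>
    simp only [map_add]
    rw [Finsupp.prod_add_index' (by simp) (by intros; rw [pow_add]),
      Finsupp.prod_add_index' (by simp) (by intros; rw [pow_add])]
    exact key hf hg
  | single s k =>
    rw [Finsupp.prod_single_index (by simp), Finsupp.prod_single_index (by simp),
      Finsupp.weight_single]
    induction k with
    | zero => simpa using mem_orderIdeal_zero (1 : MvPowerSeries τ R)
    | succ k ih =>
      rw [pow_succ, pow_succ, succ_nsmul]
      exact key ih ⟨ha s, hb s, hab s⟩

theorem subst_sub_subst_mem_orderIdeal {w : σ → ℕ} {v : τ → ℕ} {e t : ℕ}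
    {a b : σ → MvPowerSeries τ R}
    (hsa : HasSubst a) (hsb : HasSubst b)
    (ha : ∀ s, a s ∈ orderIdeal v (w s)) (hb : ∀ s, b s ∈ orderIdeal v (w s))
    (hab : ∀ s, a s - b s ∈ orderIdeal v (w s + e)) {f : MvPowerSeries σ R}
    (hf : f ∈ orderIdeal w t) : subst a f - subst b f ∈ orderIdeal v (t + e) := by
  intro m hm
  rw [map_sub, coeff_subst hsa, coeff_subst hsb, sub_eq_zero]
  refine finsum_congr fun d => ?_
  by_cases hd : Finsupp.weight w d < t
  · rw [hf d hd]; simp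
  · have := (prod_pow_sub_prod_pow_mem ha hb hab d).2.2 m (by omega)
    rw [map_sub, sub_eq_zero] at this
    rw [this]

theorem subst_mem_orderIdeal {w : σ → ℕ} {v : τ → ℕ} {t : ℕ} {a : σ → MvPowerSeries τ R}
    (hsa : HasSubst a) (ha : ∀ s, a s ∈ orderIdeal v (w s)) {f : MvPowerSeries σ R}
    (hf : f ∈ orderIdeal w t) : subst a f ∈ orderIdeal v t := by
  intro m hm
  rw [coeff_subst hsa]
  refine finsum_eq_zero_of_forall_eq_zero fun d => ?_
  by_cases hd : Finsupp.weight w d < t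
  · rw [hf d hd]; simp
  · have := (prod_pow_sub_prod_pow_mem (e := 0) ha ha (by simp) d).1 m (by omega)
    rw [this]; simp

/-- A map of formal power series which raises the order of differences by one has a fixed point. -/
theorem exists_fixed_point {t₀ : ℕ} (T : MvPowerSeries σ R → MvPowerSeries σ R)
    (h₀ : T 0 ∈ orderIdeal 1 t₀)
    (hT : ∀ t, t₀ ≤ t → ∀ f ∈ orderIdeal 1 t₀, ∀ g ∈ orderIdeal 1 t₀, f - g ∈ orderIdeal 1 t →
      T f - T g ∈ orderIdeal 1 (t + 1)) :
    ∃ f ∈ orderIdeal 1 t₀, T f = f := by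
  set s : ℕ → MvPowerSeries σ R := fun k => T^[k] 0 with hs
  have s_succ : ∀ k, s (k + 1) = T (s k) := fun k => Function.iterate_succ_apply' T k 0
  have mem_s : ∀ k, s k ∈ orderIdeal 1 t₀ := by
    intro k
    induction k with
    | zero => simp [hs]
    | succ k ih =>
      have := hT t₀ le_rfl _ ih 0 (zero_mem _) (by simpa using ih)
      rw [s_succ, ← sub_add_cancel (T (s k)) (T 0)]
      exact add_mem (orderIdeal_mono (Nat.le_succ _) this) h₀
  have step : ∀ k, s (k + 1) - s k ∈ orderIdeal 1 (t₀ + k) := by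
    intro k
    induction k with
    | zero => simpa using sub_mem (mem_s 1) (mem_s 0)
    | succ k ih =>
      rw [s_succ (k + 1), s_succ k]
      have := hT (t₀ + k) (by omega) _ (mem_s (k + 1)) _ (mem_s k) ih
      rwa [s_succ k, add_assoc] at this
  have cauchy : ∀ k j, s (k + j) - s k ∈ orderIdeal 1 (t₀ + k) := by
    intro k j
    induction j with
    | zero => simp
    | succ j ih =>
      rw [← sub_add_sub_cancel (s (k + (j + 1))) (s (k + j))]
      exact add_mem (orderIdeal_mono (by omega) (step (k + j))) ih
  -- The coefficient at `m` no longer changes from the iterate with number `m.degree + 1` on.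
  set f : MvPowerSeries σ R := fun m => coeff m (s (m.degree + 1)) with hf
  have coeff_f : ∀ m, coeff m f = coeff m (s (m.degree + 1)) := fun m => rfl
  have f_sub : ∀ k, f - s k ∈ orderIdeal 1 k := by
    intro k
    rw [mem_orderIdeal_one]
    intro m hm
    have := mem_orderIdeal_one.1 (cauchy (m.degree + 1) (k - (m.degree + 1))) m (by omega)
    rw [show m.degree + 1 + (k - (m.degree + 1)) = k by omega, map_sub, sub_eq_zero] at this
    rw [map_sub, coeff_f, this, sub_self]
  have f_mem : f ∈ orderIdeal 1 t₀ := by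
    rw [mem_orderIdeal_one]
    intro m hm
    rw [coeff_f]
    exact mem_orderIdeal_one.1 (mem_s _) m hm
  refine ⟨f, f_mem, sub_eq_zero.1 (eq_zero_of_forall_mem_orderIdeal (w := 1) t₀ fun k hk => ?_)⟩
  have h1 := hT k hk _ f_mem _ (mem_s k) (f_sub k)
  rw [← s_succ] at h1
  have := sub_mem h1 (f_sub (k + 1))
  rw [sub_sub_sub_cancel_right] at this
  exact orderIdeal_mono (Nat.le_succ _) this

theorem subst_finset_sum {ι : Type*} {a : σ → MvPowerSeries τ R} (ha : HasSubst a)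
    (s : Finset ι) (f : ι → MvPowerSeries σ R) :
    subst a (∑ i ∈ s, f i) = ∑ i ∈ s, subst a (f i) := by
  simp only [← coe_substAlgHom (R := R) ha, map_sum]

end MvPowerSeries

open MvPowerSeries

namespace CRSingular

variable {n : ℕ}

/-! ### Conjugation of series in `(z, z̄)` -/

theorem coeff_conj (f : RealSeries n) (m : Fin n ⊕ Fin n →₀ ℕ) :
    coeff m (conj f) = starRingEnd ℂ (coeff (Finsupp.mapDomain Sum.swap m) f) := rfl

/-- Splitting conjugation into conjugating the coefficients and swapping the variables makes it a
ring homomorphism that can be moved through substitutions. -/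
theorem conj_eq_subst (f : RealSeries n) :
    conj f = subst (X ∘ Sum.swap : Fin n ⊕ Fin n → RealSeries n)
      (MvPowerSeries.map (starRingEnd ℂ) f) := by
  have h := rename_eq_subst (R := ℂ) (f := (Equiv.sumComm (Fin n) (Fin n)).toEmbedding)
    (p := MvPowerSeries.map (starRingEnd ℂ) f)
  have h2 : ((Equiv.sumComm (Fin n) (Fin n)).toEmbedding : Fin n ⊕ Fin n → Fin n ⊕ Fin n)
    = Sum.swap := rfl
  refine Eq.trans ?_ h
  ext m
  have hm : m = Finsupp.embDomain (Equiv.sumComm (Fin n) (Fin n)).toEmbedding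
      (Finsupp.mapDomain Sum.swap m) := by
    rw [Finsupp.embDomain_eq_mapDomain, h2, ← Finsupp.mapDomain_comp]
    simp [Finsupp.mapDomain_id]
  conv_rhs => rw [hm]
  rw [coeff_embDomain_rename, coeff_map, coeff_conj]

/-- Conjugation of formal power series as a ring homomorphism. -/
noncomputable def conjHom (n : ℕ) : RealSeries n →+* RealSeries n :=
  (rename (R := ℂ) (Sum.swap : Fin n ⊕ Fin n → Fin n ⊕ Fin n)).toRingHom.comp
    (MvPowerSeries.map (starRingEnd ℂ))

theorem conjHom_apply (f : RealSeries n) : conjHom n f = conj f := by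
  rw [conj_eq_subst, ← rename_eq_subst]; rfl

theorem conj_add (f g : RealSeries n) : conj (f + g) = conj f + conj g := by
  simp only [← conjHom_apply, map_add]

theorem conj_sub (f g : RealSeries n) : conj (f - g) = conj f - conj g := by
  simp only [← conjHom_apply, map_sub]

theorem conj_mul (f g : RealSeries n) : conj (f * g) = conj f * conj g := by
  simp only [← conjHom_apply, map_mul]

theorem conj_sum {ι : Type*} (s : Finset ι) (f : ι → RealSeries n) :
    conj (∑ i ∈ s, f i) = ∑ i ∈ s, conj (f i) := by
  simp only [← conjHom_apply, map_sum]

theorem mapDomain_swap_swap (m : Fin n ⊕ Fin n →₀ ℕ) :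
    Finsupp.mapDomain Sum.swap (Finsupp.mapDomain Sum.swap m) = m := by
  rw [← Finsupp.mapDomain_comp]; simp [Finsupp.mapDomain_id]

theorem conj_conj (f : RealSeries n) : conj (conj f) = f := by
  ext m; rw [coeff_conj, coeff_conj, mapDomain_swap_swap]; simp

theorem conj_X (s : Fin n ⊕ Fin n) : conj (X s : RealSeries n) = X s.swap := by
  rw [← conjHom_apply]; simp [conjHom]

theorem conj_zVar (k : Fin n) : conj (zVar k) = zbarVar k := conj_X _

theorem conj_zbarVar (k : Fin n) : conj (zbarVar k) = zVar k := conj_X _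

theorem conj_absSq (k : Fin n) : conj (absSq k) = absSq k := by
  rw [absSq, conj_mul, conj_zVar, conj_zbarVar, mul_comm]

theorem conj_normSq : conj (normSq n) = normSq n := by
  simp only [normSq, conj_sum, conj_absSq]

theorem constantCoeff_conj (f : RealSeries n) :
    constantCoeff (conj f) = starRingEnd ℂ (constantCoeff f) := by
  rw [← coeff_zero_eq_constantCoeff_apply, coeff_conj]; simp

theorem conj_mem_orderIdeal {f : RealSeries n} {t : ℕ} (hf : f ∈ orderIdeal 1 t) :
    conj f ∈ orderIdeal 1 t := by
  rw [mem_orderIdeal_one] at *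
  intro m hm
  rw [coeff_conj, hf, map_zero]
  rwa [Finsupp.degree_mapDomain]

theorem hasSubst_X_comp_swap :
    HasSubst (X ∘ Sum.swap : Fin n ⊕ Fin n → RealSeries n) :=
  hasSubst_of_constantCoeff_zero (by simp)

theorem conj_subst {σ : Type*} {a : σ → RealSeries n} (ha : HasSubst a) (f : MvPowerSeries σ ℂ) :
    conj (subst a f) = subst (fun s => conj (a s)) (MvPowerSeries.map (starRingEnd ℂ) f) := by
  rw [conj_eq_subst, map_subst ha, subst_comp_subst_apply (ha.map _) hasSubst_X_comp_swap]
  simp only [← conj_eq_subst]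

theorem hasSubst_elim_conj {F : Fin n → RealSeries n} (hF : ∀ k, constantCoeff (F k) = 0) :
    HasSubst (Sum.elim F fun k => conj (F k)) :=
  hasSubst_of_constantCoeff_zero (by
    rintro (k | k)
    · exact hF k
    · simp [constantCoeff_conj, hF k])

/-- Swapping `z` with `z̄` exchanges `F` and `F̄`. Hence real-valuedness is preserved by the
substitution `(F, F̄)`. -/
theorem conj_subst_elim {F : Fin n → RealSeries n} (hF : ∀ k, constantCoeff (F k) = 0)
    (f : RealSeries n) :
    conj (subst (Sum.elim F fun k => conj (F k)) f) =
      subst (Sum.elim F fun k => conj (F k)) (conj f) := by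
  rw [conj_subst (hasSubst_elim_conj hF), conj_eq_subst f,
    subst_comp_subst_apply hasSubst_X_comp_swap (hasSubst_elim_conj hF)]
  congr 1
  ext1 s
  rw [Function.comp_apply, subst_X (hasSubst_elim_conj hF)]
  rcases s with k | k <;> simp [conj_conj]

theorem elim_zVar_zbarVar : Sum.elim (zVar : Fin n → RealSeries n) zbarVar = X := by
  ext1 s; rcases s with k | k <;> rfl

/-! ### The linear change from `|z_1|², …, |z_n|²` to `u, v_2, …, v_n` -/

/-- The matrix which expresses `u, v_2, …, v_n` through `|z_1|², …, |z_n|²`. -/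
def uvMatrix (n : ℕ) : Matrix (Fin n) (Fin n) ℂ :=
  fun k i => if (k : ℕ) = 0 then 1 else if i < k then 1 else if i = k then -1 else 0

/-- The linear forms whose coefficients are the rows of a matrix. -/
noncomputable def linForm (A : Matrix (Fin n) (Fin n) ℂ) (k : Fin n) : MvPowerSeries (Fin n) ℂ :=
  ∑ i, A k i • X i

theorem constantCoeff_linForm (A : Matrix (Fin n) (Fin n) ℂ) (k : Fin n) :
    constantCoeff (linForm A k) = 0 := by
  simp [linForm]

theorem hasSubst_linForm (A : Matrix (Fin n) (Fin n) ℂ) : HasSubst (linForm A) :=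
  hasSubst_of_constantCoeff_zero (constantCoeff_linForm A)

theorem subst_linForm_linForm (A B : Matrix (Fin n) (Fin n) ℂ) (k : Fin n) :
    subst (linForm A) (linForm B k) = linForm (B * A) k := by
  rw [linForm, subst_finset_sum (hasSubst_linForm A)]
  simp only [subst_smul (hasSubst_linForm A), subst_X (hasSubst_linForm A)]
  simp only [linForm, Finset.smul_sum, Matrix.mul_apply, Finset.sum_smul, smul_smul]
  rw [Finset.sum_comm]

theorem linForm_one : linForm (1 : Matrix (Fin n) (Fin n) ℂ) = X := by
  ext1 k
  simp [linForm, Matrix.one_apply]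

theorem subst_linForm_subst_linForm {A B : Matrix (Fin n) (Fin n) ℂ} (h : A * B = 1)
    (f : MvPowerSeries (Fin n) ℂ) : subst (linForm B) (subst (linForm A) f) = f := by
  rw [subst_comp_subst_apply (hasSubst_linForm A) (hasSubst_linForm B)]
  simp only [subst_linForm_linForm, h, linForm_one]
  rw [subst_self]; rfl

theorem uvMatrix_mulVec_apply (x : Fin n → ℂ) {k : Fin n} (hk : (k : ℕ) ≠ 0) :
    (uvMatrix n).mulVec x k = (∑ i with i < k, x i) - x k := by
  have : ∀ i, uvMatrix n k i * x i = (if i < k then x i else 0) - if i = k then x i else 0 := by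
    intro i
    simp only [uvMatrix, if_neg hk]
    split_ifs with h1 h2 <;> simp_all
  simp only [Matrix.mulVec, dotProduct, this, Finset.sum_sub_distrib, Finset.sum_filter]
  simp

/-- On the kernel, row `k ≠ 0` says that `x_k` equals the sum of the preceding entries, so each
partial sum is twice the one before. Row `0` says that the full sum vanishes. Halving downwards, all
partial sums vanish, and so do the entries. -/
theorem uvMatrix_mulVec_injective : Function.Injective (uvMatrix n).mulVec := by
  rw [← Matrix.coe_mulVecLin, ← LinearMap.ker_eq_bot, LinearMap.ker_eq_bot']
  intro x hx
  rw [Matrix.mulVecLin_apply] at hx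
  have hsucc : ∀ k : Fin n, ∑ i : Fin n with i.val < k.val + 1, x i =
      (∑ i : Fin n with i.val < k.val, x i) + x k := by
    intro k
    have : Finset.univ.filter (fun i : Fin n => i.val < k.val + 1) =
        insert k (Finset.univ.filter fun i : Fin n => i.val < k.val) := by
      ext i; simp [Fin.ext_iff]; omega
    rw [this, Finset.sum_insert (by simp), add_comm]
  have hrow : ∀ k : Fin n, (k : ℕ) ≠ 0 → (∑ i : Fin n with i.val < k.val, x i) = x k := by
    intro k hk
    have := congrFun hx k
    rw [uvMatrix_mulVec_apply x hk] at this
    exact sub_eq_zero.1 this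
  -- Downward induction on `m`, carried by `j = n - m`.
  have hzero : ∀ j m : ℕ, m + j = n → m ≠ 0 → ∑ i : Fin n with i.val < m, x i = 0 := by
    intro j
    induction j with
    | zero =>
      intro m hm h0
      have := congrFun hx ⟨0, by omega⟩
      rw [Matrix.mulVec, dotProduct] at this
      simp only [uvMatrix, if_true, one_mul] at this
      rw [Finset.filter_true_of_mem (fun i _ => by omega)]
      exact this
    | succ j ih =>
      intro m hm h0
      have h1 := ih (m + 1) (by omega) (by omega)
      have h2 := hsucc ⟨m, by omega⟩
      have h3 := hrow ⟨m, by omega⟩ h0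
      simp only at h2 h3
      rw [h1, ← h3] at h2
      linear_combination -h2 / 2
  ext k
  have h1 := hsucc k
  rw [hzero (n - (k.val + 1)) (k.val + 1) (by omega) (by omega)] at h1
  by_cases hk : (k : ℕ) = 0
  · rw [Finset.filter_false_of_mem (fun i _ => by omega)] at h1
    simpa using h1.symm
  · rw [hzero (n - k.val) k.val (by omega) hk] at h1
    simpa using h1.symm

theorem isUnit_uvMatrix : IsUnit (uvMatrix n) :=
  Matrix.mulVec_injective_iff_isUnit.1 uvMatrix_mulVec_injective

theorem uvMatrix_mul_inv : uvMatrix n * (uvMatrix n)⁻¹ = 1 :=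
  Matrix.mul_nonsing_inv _ ((Matrix.isUnit_iff_isUnit_det _).1 isUnit_uvMatrix)

theorem inv_mul_uvMatrix : (uvMatrix n)⁻¹ * uvMatrix n = 1 :=
  Matrix.nonsing_inv_mul _ ((Matrix.isUnit_iff_isUnit_det _).1 isUnit_uvMatrix)

/-! ### Existence and uniqueness of the expansion in `z^I z̄^J u^{k_1} v_2^{k_2} ⋯ v_n^{k_n}` -/

theorem hasSubst_absSq : HasSubst (absSq : Fin n → RealSeries n) :=
  hasSubst_of_constantCoeff_zero (by simp [absSq, zVar, zbarVar])

/-- The series `f(|z_1|², …, |z_n|²)`. -/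
noncomputable def diag (f : MvPowerSeries (Fin n) ℂ) : RealSeries n := subst absSq f

theorem absSq_eq_monomial (k : Fin n) :
    absSq k = monomial (Finsupp.sumElim (Finsupp.single k 1) (Finsupp.single k 1)) (1 : ℂ) := by
  rw [absSq, zVar, zbarVar, X_def, X_def, monomial_mul_monomial, mul_one,
    Finsupp.sumElim_single_single]

theorem prod_absSq_pow (d : Fin n →₀ ℕ) :
    (d.prod fun k j => absSq k ^ j) = monomial (Finsupp.sumElim d d) (1 : ℂ) := by
  induction d using Finsupp.induction_linear with
  | zero => simp
  | add f g hf hg =>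
    rw [Finsupp.prod_add_index' (by simp) (by intros; rw [pow_add]), hf, hg,
      monomial_mul_monomial, mul_one, ← Finsupp.sumElim_add]
  | single k j =>
    rw [Finsupp.prod_single_index (by simp), absSq_eq_monomial, monomial_pow, one_pow]
    simp

theorem sumElim_injective {P Q P' Q' : Fin n →₀ ℕ}
    (h : Finsupp.sumElim P Q = Finsupp.sumElim P' Q') : P = P' ∧ Q = Q' := by
  constructor
  · ext i; simpa using DFunLike.congr_fun h (Sum.inl i)
  · ext i; simpa using DFunLike.congr_fun h (Sum.inr i)

theorem coeff_diag (f : MvPowerSeries (Fin n) ℂ) (P Q : Fin n →₀ ℕ) :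
    coeff (Finsupp.sumElim P Q) (diag f) = if P = Q then coeff P f else 0 := by
  classical
  rw [diag, coeff_subst hasSubst_absSq, finsum_eq_single _ P]
  · rw [prod_absSq_pow, coeff_monomial]
    by_cases h : P = Q
    · subst h; simp
    · rw [if_neg, if_neg h, smul_zero]
      intro h'; exact h (sumElim_injective h').2.symm
  · intro d hd
    rw [prod_absSq_pow, coeff_monomial, if_neg, smul_zero]
    intro h'; exact hd (sumElim_injective h').1.symm

/-- The coefficients of `f` at `z^{I+L} z̄^{J+L}`, as a power series in variables indexed by `L`. -/
noncomputable def slice (I J : Fin n →₀ ℕ) : RealSeries n →ₗ[ℂ] MvPowerSeries (Fin n) ℂ where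
  toFun f := fun L => coeff (Finsupp.sumElim (I + L) (J + L)) f
  map_add' _ _ := rfl
  map_smul' _ _ := rfl

theorem coeff_slice (I J L : Fin n →₀ ℕ) (f : RealSeries n) :
    coeff L (slice I J f) = coeff (Finsupp.sumElim (I + L) (J + L)) f := rfl

theorem exists_disjoint_add (P Q : Fin n →₀ ℕ) :
    ∃ I J L : Fin n →₀ ℕ, (∀ k, I k * J k = 0) ∧ P = I + L ∧ Q = J + L := by
  refine ⟨P - P ⊓ Q, Q - P ⊓ Q, P ⊓ Q, fun k => ?_, ?_, ?_⟩
  · simp only [Finsupp.tsub_apply, Finsupp.inf_apply, mul_eq_zero]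
    rcases le_total (P k) (Q k) with h | h <;> simp [h]
  · rw [tsub_add_cancel_of_le inf_le_left]
  · rw [tsub_add_cancel_of_le inf_le_right]

theorem exists_sumElim (m : Fin n ⊕ Fin n →₀ ℕ) : ∃ P Q, m = Finsupp.sumElim P Q :=
  ⟨_, _, (Finsupp.comapDomain_sumElim_comapDomain m).symm⟩

theorem coeff_monomial_mul_diag (I J P Q : Fin n →₀ ℕ) (f : MvPowerSeries (Fin n) ℂ) :
    coeff (Finsupp.sumElim P Q) (monomial (Finsupp.sumElim I J) (1 : ℂ) * diag f) =
      if I ≤ P ∧ J ≤ Q ∧ P - I = Q - J then coeff (P - I) f else 0 := by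
  classical
  rw [coeff_monomial_mul]
  have h1 : Finsupp.sumElim I J ≤ Finsupp.sumElim P Q ↔ I ≤ P ∧ J ≤ Q := by
    simp only [Finsupp.le_def, Sum.forall, Finsupp.sumElim_inl, Finsupp.sumElim_inr]
  have h2 : Finsupp.sumElim P Q - Finsupp.sumElim I J = Finsupp.sumElim (P - I) (Q - J) := by
    ext (i | i) <;> simp
  rw [h2, coeff_diag]
  by_cases h : I ≤ P ∧ J ≤ Q
  · rw [if_pos (h1.2 h)]
    by_cases h3 : P - I = Q - J <;> simp [h, h3]
  · rw [if_neg (fun h' => h (h1.1 h')), if_neg (fun h' => h ⟨h'.1, h'.2.1⟩)]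

theorem eq_of_disjoint_of_add_eq {I J I' J' L L' : Fin n →₀ ℕ} (h : ∀ k, I k * J k = 0)
    (h' : ∀ k, I' k * J' k = 0) (h1 : I + L = I' + L') (h2 : J + L = J' + L') :
    I = I' ∧ J = J' := by
  have key : ∀ k, I k = I' k ∧ J k = J' k := by
    intro k
    have a1 := DFunLike.congr_fun h1 k
    have a2 := DFunLike.congr_fun h2 k
    have b1 := h k
    have b2 := h' k
    simp only [Finsupp.add_apply] at a1 a2
    rcases Nat.mul_eq_zero.1 b1 with h | h <;> rcases Nat.mul_eq_zero.1 b2 with h' | h' <;> omega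
  exact ⟨Finsupp.ext fun k => (key k).1, Finsupp.ext fun k => (key k).2⟩

/-- Every monomial is uniquely `z^I z̄^J ∏ |z_k|^{2 L_k}` with `I` and `J` disjoint. Different
disjoint pairs therefore involve different monomials and can be treated separately. -/
theorem slice_monomial_mul_diag {I J I' J' : Fin n →₀ ℕ} (h : ∀ k, I k * J k = 0)
    (h' : ∀ k, I' k * J' k = 0) (f : MvPowerSeries (Fin n) ℂ) :
    slice I' J' (monomial (Finsupp.sumElim I J) (1 : ℂ) * diag f) =
      if I = I' ∧ J = J' then f else 0 := by
  ext L
  rw [coeff_slice, coeff_monomial_mul_diag]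
  by_cases hI : I = I' ∧ J = J'
  · obtain ⟨rfl, rfl⟩ := hI
    simp
  · rw [if_neg hI, if_neg, coeff_zero]
    rintro ⟨h1, h2, h3⟩
    refine hI (eq_of_disjoint_of_add_eq (L := I' + L - I) (L' := L) h h' ?_ ?_)
    · rw [add_tsub_cancel_of_le h1]
    · rw [h3, add_tsub_cancel_of_le h2]

theorem uv_eq_diag (k : Fin n) : uv k = diag (linForm (uvMatrix n) k) := by
  rw [diag, linForm, subst_finset_sum hasSubst_absSq]
  simp only [subst_smul hasSubst_absSq, subst_X hasSubst_absSq, uv, uvMatrix]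
  by_cases hk : (k : ℕ) = 0
  · simp [hk, normSq]
  · have : ∀ i : Fin n, ((if i < k then (1 : ℂ) else if i = k then -1 else 0) • absSq i) =
        (if i < k then absSq i else 0) - if i = k then absSq i else 0 := by
      intro i
      split_ifs with h1 h2 <;> simp_all
    simp only [if_neg hk, this, Finset.sum_sub_distrib, Finset.sum_filter]
    simp

theorem expTerm_eq (I J K : Fin n →₀ ℕ) :
    expTerm I J K = monomial (Finsupp.sumElim I J) (1 : ℂ) *
      diag (K.prod fun k j => linForm (uvMatrix n) k ^ j) := by
  have h1 : (∏ k, zVar k ^ I k) * (∏ k, zbarVar k ^ J k) =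
      monomial (Finsupp.sumElim I J) (1 : ℂ) := by
    rw [monomial_eq', ← Finsupp.prod_fintype _ _ (by simp), ← Finsupp.prod_fintype _ _ (by simp),
      Finsupp.prod_sumElim]
    simp only [map_one, one_mul]
    rfl
  rw [expTerm, h1, Finsupp.prod_fintype _ _ (by simp), diag,
    ← coe_substAlgHom (R := ℂ) hasSubst_absSq, map_prod]
  simp only [map_pow, uv_eq_diag, diag, coe_substAlgHom]

-- For each disjoint pair `(I, J)` the expansion is only a linear change of variables in a power
-- series in `|z_1|², …, |z_n|²`. As the matrix is invertible, this yields both existence and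
-- uniqueness of the coefficients.
open scoped MvPowerSeries.WithPiTopology in
theorem isExpansion_iff_slice {φ : RealSeries n}
    {c : (Fin n →₀ ℕ) → (Fin n →₀ ℕ) → (Fin n →₀ ℕ) → ℂ} :
    IsExpansion φ c ↔ ∀ I J : Fin n →₀ ℕ, (∀ k, I k * J k = 0) →
      slice I J φ = subst (linForm (uvMatrix n)) (ofCoeff (c I J)) := by
  have key : ∀ I J L : Fin n →₀ ℕ, (∀ k, I k * J k = 0) →
      (HasSum (fun p : ExpIndex n => coeff (Finsupp.sumElim (I + L) (J + L))
        (c p.1.1 p.1.2.1 p.1.2.2 • expTerm p.1.1 p.1.2.1 p.1.2.2))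
        (coeff (Finsupp.sumElim (I + L) (J + L)) φ) ↔
      coeff L (slice I J φ) =
        coeff L (subst (linForm (uvMatrix n)) (ofCoeff (c I J)))) := by
    intro I J L hIJ
    have hval : ∀ p : ExpIndex n, coeff (Finsupp.sumElim (I + L) (J + L))
        (c p.1.1 p.1.2.1 p.1.2.2 • expTerm p.1.1 p.1.2.1 p.1.2.2) =
        if p.1.1 = I ∧ p.1.2.1 = J then c p.1.1 p.1.2.1 p.1.2.2 •
          coeff L (p.1.2.2.prod fun k j => linForm (uvMatrix n) k ^ j) else 0 := by
      intro p
      rw [expTerm_eq, ← coeff_slice, LinearMap.map_smul, slice_monomial_mul_diag p.2 hIJ]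
      split_ifs <;> simp
    let g : (Fin n →₀ ℕ) → ExpIndex n := fun K => ⟨(I, J, K), hIJ⟩
    have hg : Function.Injective g := by
      intro K K' h
      simpa [g] using h
    simp only [hval]
    rw [← hg.hasSum_iff]
    -- The linear forms have no constant term, so only finitely many `K` contribute to a given
    -- coefficient, and the topological sum is a finite one.
    · have hfin := coeff_subst_finite (hasSubst_linForm (uvMatrix n))
        (ofCoeff (c I J)) L
      rw [coeff_subst (hasSubst_linForm _), coeff_slice]
      have e1 : ((fun p : ExpIndex n => if p.1.1 = I ∧ p.1.2.1 = J then c p.1.1 p.1.2.1 p.1.2.2 •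
          coeff L (p.1.2.2.prod fun k j => linForm (uvMatrix n) k ^ j) else 0) ∘ g) =
          fun K => coeff K (ofCoeff (c I J)) •
            coeff L (K.prod fun k j => linForm (uvMatrix n) k ^ j) := by
        ext K; simp [g]
      rw [e1]
      constructor
      · intro h
        rw [← h.tsum_eq, tsum_eq_finsum hfin]
      · intro h
        have hs := (summable_of_hasFiniteSupport (L := .unconditional _) hfin).hasSum
        rw [tsum_eq_finsum hfin] at hs
        rw [h]
        exact hs
    · rintro ⟨⟨I', J', K⟩, hp⟩ hx
      rw [if_neg]
      rintro ⟨h1, h2⟩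
      simp only at h1 h2
      subst h1 h2
      exact hx ⟨K, rfl⟩
  rw [IsExpansion, WithPiTopology.hasSum_iff_hasSum_coeff]
  constructor
  · intro h I J hIJ
    ext L
    exact (key I J L hIJ).1 (h _)
  · intro h m
    obtain ⟨P, Q, rfl⟩ := exists_sumElim m
    obtain ⟨I, J, L, hIJ, rfl, rfl⟩ := exists_disjoint_add P Q
    exact (key I J L hIJ).2 (by rw [h I J hIJ])

/-- The coefficients of the expansion of `φ`, as a power series in `u, v_2, …, v_n`. -/
noncomputable def expCoeff (φ : RealSeries n) (I J : Fin n →₀ ℕ) : MvPowerSeries (Fin n) ℂ :=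
  subst (linForm (uvMatrix n)⁻¹) (slice I J φ)

theorem subst_expCoeff (φ : RealSeries n) (I J : Fin n →₀ ℕ) :
    subst (linForm (uvMatrix n)) (expCoeff φ I J) = slice I J φ :=
  subst_linForm_subst_linForm inv_mul_uvMatrix _

theorem expCoeff_eq_of_slice {φ : RealSeries n} {I J : Fin n →₀ ℕ} {f : MvPowerSeries (Fin n) ℂ}
    (h : slice I J φ = subst (linForm (uvMatrix n)) f) : expCoeff φ I J = f := by
  rw [expCoeff, h, subst_linForm_subst_linForm uvMatrix_mul_inv]

theorem isExpansion_expCoeff (φ : RealSeries n) : IsExpansion φ fun I J K => coeff K (expCoeff φ I J) :=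
  isExpansion_iff_slice.2 fun I J _ => (subst_expCoeff φ I J).symm

theorem IsExpansion.eq_coeff {φ : RealSeries n}
    {c : (Fin n →₀ ℕ) → (Fin n →₀ ℕ) → (Fin n →₀ ℕ) → ℂ} (h : IsExpansion φ c)
    {I J : Fin n →₀ ℕ} (hIJ : ∀ k, I k * J k = 0) (K : Fin n →₀ ℕ) :
    c I J K = coeff K (expCoeff φ I J) := by
  rw [expCoeff_eq_of_slice (isExpansion_iff_slice.1 h I J hIJ), coeff_ofCoeff]

theorem expCoeff_add (φ ψ : RealSeries n) (I J : Fin n →₀ ℕ) :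
    expCoeff (φ + ψ) I J = expCoeff φ I J + expCoeff ψ I J := by
  rw [expCoeff, map_add, subst_add (hasSubst_linForm _)]; rfl

theorem expCoeff_sub (φ ψ : RealSeries n) (I J : Fin n →₀ ℕ) :
    expCoeff (φ - ψ) I J = expCoeff φ I J - expCoeff ψ I J := by
  rw [expCoeff, map_sub, subst_sub (hasSubst_linForm _)]; rfl

theorem expCoeff_sum {ι : Type*} (s : Finset ι) (φ : ι → RealSeries n) (I J : Fin n →₀ ℕ) :
    expCoeff (∑ i ∈ s, φ i) I J = ∑ i ∈ s, expCoeff (φ i) I J := by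
  simp only [expCoeff, map_sum, subst_finset_sum (hasSubst_linForm _)]

theorem slice_conj (φ : RealSeries n) (I J : Fin n →₀ ℕ) :
    slice I J (conj φ) = MvPowerSeries.map (starRingEnd ℂ) (slice J I φ) := by
  ext L
  rw [coeff_map, coeff_slice, coeff_slice, coeff_conj, Finsupp.mapDomain_swap_sumElim]

theorem map_linForm_uvMatrix (k : Fin n) :
    MvPowerSeries.map (starRingEnd ℂ) (linForm (uvMatrix n) k) = linForm (uvMatrix n) k := by
  rw [linForm, map_sum]
  refine Finset.sum_congr rfl fun i _ => ?_
  rw [smul_eq_C_mul, map_mul, map_C, map_X]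
  congr 2
  simp only [uvMatrix]
  split_ifs <;> simp

/-- The series `u` and `v_k` are real, so conjugation swaps `I` with `J` and conjugates the
coefficients. -/
theorem expCoeff_conj (φ : RealSeries n) (I J : Fin n →₀ ℕ) :
    expCoeff (conj φ) I J = MvPowerSeries.map (starRingEnd ℂ) (expCoeff φ J I) := by
  apply expCoeff_eq_of_slice
  rw [slice_conj, ← subst_expCoeff, map_subst (hasSubst_linForm _)]
  simp only [map_linForm_uvMatrix]

theorem linForm_mem_orderIdeal (A : Matrix (Fin n) (Fin n) ℂ) (k : Fin n) :
    linForm A k ∈ orderIdeal 1 ((1 : Fin n → ℕ) k) :=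
  mem_orderIdeal_one_one.2 (constantCoeff_linForm A k)

/-- The term with indices `(I, J, K)` is homogeneous of degree `|I| + |J| + 2|K|`, and the linear
change of variables respects this grading. With the converse `mem_orderIdeal_of_expCoeff`, orders
can be read off from the expansion. -/
theorem coeff_expCoeff_eq_zero {φ : RealSeries n} {t : ℕ} (h : φ ∈ orderIdeal 1 t)
    {I J K : Fin n →₀ ℕ} (ht : I.degree + J.degree + 2 * K.degree < t) :
    coeff K (expCoeff φ I J) = 0 := by
  have h1 : slice I J φ ∈ orderIdeal 1 (K.degree + 1) := by
    rw [mem_orderIdeal_one]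
    intro L hL
    rw [coeff_slice]
    refine mem_orderIdeal_one.1 h _ ?_
    rw [Finsupp.sumElim_eq_add]
    simp only [map_add, Finsupp.degree_mapDomain]
    omega
  exact mem_orderIdeal_one.1
    (subst_mem_orderIdeal (hasSubst_linForm _) (linForm_mem_orderIdeal _) h1) K (by omega)

theorem mem_orderIdeal_of_expCoeff {φ : RealSeries n} {t : ℕ}
    (h : ∀ I J : Fin n →₀ ℕ, (∀ k, I k * J k = 0) → ∀ K : Fin n →₀ ℕ,
      I.degree + J.degree + 2 * K.degree < t → coeff K (expCoeff φ I J) = 0) :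
    φ ∈ orderIdeal 1 t := by
  rw [mem_orderIdeal_one]
  intro m hm
  obtain ⟨P, Q, rfl⟩ := exists_sumElim m
  obtain ⟨I, J, L, hIJ, rfl, rfl⟩ := exists_disjoint_add P Q
  rw [Finsupp.sumElim_eq_add] at hm
  simp only [map_add, Finsupp.degree_mapDomain] at hm
  rw [← coeff_slice, ← subst_expCoeff]
  have h1 : expCoeff φ I J ∈ orderIdeal 1 (L.degree + 1) := by
    rw [mem_orderIdeal_one]
    intro K hK
    exact h I J hIJ K (by omega)
  exact mem_orderIdeal_one.1
    (subst_mem_orderIdeal (hasSubst_linForm _) (linForm_mem_orderIdeal _) h1) L (by omega)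

/-! ### Expansions of `g(z, u)` and `∑ z̄_h f_h(z, u)` -/

theorem finsum_eq_finsum_comp_of_injective {α β M : Type*} [AddCommMonoid M] {g : α → β}
    (hg : Function.Injective g) (f : β → M) (hf : ∀ x, x ∉ Set.range g → f x = 0) :
    ∑ᶠ x, f x = ∑ᶠ a, f (g a) := by
  rw [← finsum_mem_range hg, finsum_mem_def]
  refine finsum_congr fun x => ?_
  by_cases hx : x ∈ Set.range g
  · simp [hx]
  · simp [hx, hf x hx]

theorem hasSubst_elim_zVar {Φ : RealSeries n} (hΦ : constantCoeff Φ = 0) :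
    HasSubst (Sum.elim zVar (fun _ : Unit => Φ) : Fin n ⊕ Unit → RealSeries n) :=
  hasSubst_of_constantCoeff_zero (by
    rintro (k | k)
    · simp [zVar]
    · exact hΦ)

theorem constantCoeff_normSq : constantCoeff (normSq n) = 0 := by
  simp [normSq, absSq, zVar, zbarVar]

theorem normSq_eq_diag : normSq n = diag (∑ i, X i) := by
  rw [diag, subst_finset_sum hasSubst_absSq]
  simp only [subst_X hasSubst_absSq, normSq]

theorem diag_pow (f : MvPowerSeries (Fin n) ℂ) (k : ℕ) : diag (f ^ k) = diag f ^ k :=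
  subst_pow hasSubst_absSq _ _

/-- The exponent of `z^I w^k`. -/
noncomputable abbrev holIndex (I : Fin n →₀ ℕ) (k : ℕ) : Fin n ⊕ Unit →₀ ℕ :=
  Finsupp.sumElim I (Finsupp.single () k)

theorem exists_holIndex (d : Fin n ⊕ Unit →₀ ℕ) : ∃ I k, d = holIndex I k := by
  refine ⟨d.comapDomain Sum.inl Sum.inl_injective.injOn, d (Sum.inr ()), ?_⟩
  ext (i | i) <;> simp [holIndex]

theorem prod_elim_zVar_normSq (I : Fin n →₀ ℕ) (k : ℕ) :
    ((holIndex I k).prod fun s j => (Sum.elim zVar (fun _ => normSq n) s : RealSeries n) ^ j) =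
      monomial (Finsupp.sumElim I 0) (1 : ℂ) * diag ((∑ i, X i) ^ k) := by
  rw [Finsupp.prod_sumElim, diag_pow, ← normSq_eq_diag, monomial_eq', Finsupp.prod_sumElim]
  rw [Finsupp.prod_single_index (by simp)]
  simp only [Finsupp.prod_zero_index, mul_one, map_one, one_mul]
  rfl

theorem slice_zbarVar_mul_of_ne_zero (φ : RealSeries n) {I J : Fin n →₀ ℕ} {h : Fin n}
    (hJ : J h ≠ 0) : slice I J (zbarVar h * φ) = slice I (J - e h) φ := by
  classical
  ext L
  have h1 : Finsupp.single (Sum.inr h) 1 ≤ Finsupp.sumElim (I + L) (J + L) := by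
    rw [Finsupp.single_le_iff]; simp; omega
  rw [coeff_slice, coeff_slice, zbarVar, X_def, coeff_monomial_mul, if_pos h1, one_mul]
  congr 2
  ext (i | i)
  · simp
  · by_cases hi : i = h
    · subst hi; simp; omega
    · simp [hi]

/-- When `J` does not contain `h`, the factor `z̄_h` must combine with a factor `z_h`. It then
produces `|z_h|²`, which is the variable `X h` of the slice. -/
theorem slice_zbarVar_mul_of_eq_zero (φ : RealSeries n) {I J : Fin n →₀ ℕ} {h : Fin n}
    (hJ : J h = 0) : slice I J (zbarVar h * φ) = X h * slice (I + e h) J φ := by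
  classical
  ext L
  rw [coeff_slice, zbarVar, X_def, coeff_monomial_mul, X_def, coeff_monomial_mul]
  simp only [Finsupp.single_le_iff, Finsupp.sumElim_inr, Finsupp.add_apply, hJ, zero_add, one_mul]
  split_ifs with hL
  · rw [coeff_slice]
    congr 2
    ext (i | i)
    · by_cases hi : i = h
      · subst hi; simp; omega
      · simp [hi]
    · by_cases hi : i = h
      · subst hi; simp [hJ]
      · simp [hi]
  · rfl

theorem coeff_zero_sum_X_mul (β : Fin n → MvPowerSeries (Fin n) ℂ) :
    coeff 0 (∑ j, X j * β j) = 0 := by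
  simp

section

variable [NeZero n]

/-- The series `∑ a_k u^k` in the variables `u, v_2, …, v_n`. -/
noncomputable def uSeries (a : ℕ → ℂ) : MvPowerSeries (Fin n) ℂ :=
  ofCoeff fun K => if K = Finsupp.single 0 (K 0) then a (K 0) else 0

theorem linForm_uvMatrix_zero : linForm (uvMatrix n) 0 = ∑ i, X i := by
  simp [linForm, uvMatrix]

theorem coeff_subst_uSeries (a : ℕ → ℂ) (L : Fin n →₀ ℕ) :
    coeff L (subst (linForm (uvMatrix n)) (uSeries a)) =
      ∑ᶠ k, a k • coeff L ((∑ i, X i : MvPowerSeries (Fin n) ℂ) ^ k) := by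
  rw [coeff_subst (hasSubst_linForm _),
    finsum_eq_finsum_comp_of_injective (g := fun k : ℕ => Finsupp.single (0 : Fin n) k)
      (Finsupp.single_injective 0)]
  · refine finsum_congr fun k => ?_
    rw [Finsupp.prod_single_index (by simp), linForm_uvMatrix_zero]
    simp [uSeries]
  · intro K hK
    rw [uSeries, coeff_ofCoeff, if_neg, zero_smul]
    intro h
    exact hK ⟨K 0, h.symm⟩

/-- The coefficient of `z^I` in a formal power series in `(z, w)`, as a series in `u`. -/
noncomputable def holCoeff (g : HolSeries n) (I : Fin n →₀ ℕ) : MvPowerSeries (Fin n) ℂ :=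
  uSeries fun k => coeff (holIndex I k) g

theorem slice_restrict_normSq (g : HolSeries n) {I J : Fin n →₀ ℕ} (h : ∀ k, I k * J k = 0) :
    slice I J (restrict (normSq n) g) =
      if J = 0 then subst (linForm (uvMatrix n)) (holCoeff g I) else 0 := by
  ext L
  have hsub := hasSubst_elim_zVar (n := n) constantCoeff_normSq
  have hval : ∀ I' k, coeff (Finsupp.sumElim (I + L) (J + L)) ((holIndex I' k).prod
      fun s j => (Sum.elim zVar (fun _ => normSq n) s : RealSeries n) ^ j) =
      if I' = I ∧ 0 = J then coeff L ((∑ i, X i : MvPowerSeries (Fin n) ℂ) ^ k) else 0 := by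
    intro I' k
    rw [prod_elim_zVar_normSq, ← coeff_slice, slice_monomial_mul_diag (by simp) h]
    split_ifs <;> simp
  rw [coeff_slice, restrict, coeff_subst hsub]
  by_cases hJ : J = 0
  · rw [if_pos hJ, holCoeff, coeff_subst_uSeries,
      finsum_eq_finsum_comp_of_injective (g := fun k : ℕ => holIndex I k)]
    · refine finsum_congr fun k => ?_
      rw [hval, if_pos ⟨rfl, hJ.symm⟩]
    · intro k k' hkk
      simpa using DFunLike.congr_fun hkk (Sum.inr ())
    · intro d hd
      obtain ⟨I', k, rfl⟩ := exists_holIndex d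
      rw [hval, if_neg, smul_zero]
      rintro ⟨rfl, -⟩
      exact hd ⟨k, rfl⟩
  · rw [if_neg hJ, coeff_zero]
    refine finsum_eq_zero_of_forall_eq_zero fun d => ?_
    obtain ⟨I', k, rfl⟩ := exists_holIndex d
    rw [hval, if_neg (fun h' => hJ h'.2.symm), smul_zero]

theorem expCoeff_restrict_normSq (g : HolSeries n) {I J : Fin n →₀ ℕ} (h : ∀ k, I k * J k = 0) :
    expCoeff (restrict (normSq n) g) I J = if J = 0 then holCoeff g I else 0 := by
  apply expCoeff_eq_of_slice
  rw [slice_restrict_normSq g h]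
  split_ifs
  · rfl
  · rw [← coe_substAlgHom (R := ℂ) (hasSubst_linForm _), map_zero]

theorem expCoeff_zbarVar_mul_restrict (f : HolSeries n) (h : Fin n) {I J : Fin n →₀ ℕ}
    (hIJ : ∀ k, I k * J k = 0) (hJ : J ≠ 0) :
    expCoeff (zbarVar h * restrict (normSq n) f) I J = if J = e h then holCoeff f I else 0 := by
  apply expCoeff_eq_of_slice
  by_cases hJh : J h = 0
  · rw [slice_zbarVar_mul_of_eq_zero _ hJh, slice_restrict_normSq, if_neg hJ, if_neg, mul_zero,
      ← coe_substAlgHom (R := ℂ) (hasSubst_linForm _), map_zero]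
    · rintro rfl; simp at hJh
    · intro k
      by_cases hk : k = h
      · subst hk; simp [hJh]
      · simpa [Finsupp.single_apply, Ne.symm hk] using hIJ k
  · have hle : e h ≤ J := by rw [e, Finsupp.single_le_iff]; omega
    have hJe : J - e h = 0 ↔ J = e h := by
      rw [tsub_eq_zero_iff_le]
      exact ⟨fun h' => le_antisymm h' hle, fun h' => h'.le⟩
    rw [slice_zbarVar_mul_of_ne_zero _ hJh, slice_restrict_normSq]
    · simp only [hJe]
      split_ifs
      · rfl
      · rw [← coe_substAlgHom (R := ℂ) (hasSubst_linForm _), map_zero]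
    · intro k
      rcases Nat.mul_eq_zero.1 (hIJ k) with h' | h' <;> simp [h']

theorem uSeries_sum_smul {ι : Type*} (s : Finset ι) (m : ι → ℂ) (β : ι → ℕ → ℂ) :
    (uSeries fun k => ∑ j ∈ s, m j * β j k : MvPowerSeries (Fin n) ℂ) =
      ∑ j ∈ s, m j • uSeries (β j) := by
  ext K
  simp only [uSeries, map_sum, coeff_ofCoeff, coeff_smul]
  split_ifs <;> simp

/-- The terms in question are `z^I |z_h|² u^k`. Weighting `|z_h|²` by column `h` of `uvMatrix` and
summing over `h` reassembles `u, v_2, …, v_n`. Thus the coefficients `β j k` at `z^I u^k y_j`, with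
`y = (u, v_2, …, v_n)`, can be prescribed at will, without inverting the matrix. -/
theorem expCoeff_sum_zbarVar_mul_restrict (f : Fin n → HolSeries n) (I : Fin n →₀ ℕ)
    (β : Fin n → ℕ → ℂ)
    (hf : ∀ h k, coeff (holIndex (I + e h) k) (f h) = ∑ j, uvMatrix n j h * β j k) :
    expCoeff (∑ h, zbarVar h * restrict (normSq n) (f h)) I 0 = ∑ j, X j * uSeries (β j) := by
  apply expCoeff_eq_of_slice
  have h1 : ∀ h, slice I 0 (zbarVar h * restrict (normSq n) (f h)) =
      ∑ j, (uvMatrix n j h • X h) * subst (linForm (uvMatrix n)) (uSeries (β j)) := by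
    intro h
    rw [slice_zbarVar_mul_of_eq_zero _ (by simp), slice_restrict_normSq _ (by simp), if_pos rfl,
      holCoeff]
    simp only [hf, uSeries_sum_smul]
    rw [subst_finset_sum (hasSubst_linForm _), Finset.mul_sum]
    refine Finset.sum_congr rfl fun j _ => ?_
    rw [subst_smul (hasSubst_linForm _), mul_smul_comm, smul_mul_assoc]
  rw [map_sum, subst_finset_sum (hasSubst_linForm _)]
  simp only [h1]
  rw [Finset.sum_comm]
  refine Finset.sum_congr rfl fun j _ => ?_
  rw [subst_mul (hasSubst_linForm _), subst_X (hasSubst_linForm _), ← Finset.sum_mul]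
  rfl

theorem coeff_uSeries (a : ℕ → ℂ) (k : ℕ) :
    coeff (k • e (0 : Fin n)) (uSeries a) = a k := by
  simp [uSeries]

theorem coeff_uSeries_of_ne_zero (a : ℕ → ℂ) {K : Fin n →₀ ℕ} {i : Fin n} (hi : i ≠ 0)
    (hK : K i ≠ 0) : coeff K (uSeries a) = 0 := by
  rw [uSeries, coeff_ofCoeff, if_neg]
  intro h
  rw [h, Finsupp.single_eq_of_ne hi] at hK
  exact hK rfl

theorem coeff_sum_X_mul_uSeries (β : Fin n → ℕ → ℂ) (k : ℕ) (i : Fin n) :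
    coeff (k • e 0 + e i) (∑ j, X j * uSeries (β j)) = β i k := by
  classical
  rw [map_sum, Finset.sum_eq_single i]
  · rw [X_def, add_comm, coeff_add_monomial_mul, one_mul, coeff_uSeries]
  · intro j _ hj
    rw [X_def, coeff_monomial_mul]
    split_ifs with hle
    · rw [one_mul]
      by_cases hi : i = 0
      · subst hi
        rw [Finsupp.single_le_iff] at hle
        simp [Ne.symm hj] at hle
      · refine coeff_uSeries_of_ne_zero _ hi ?_
        simp [Ne.symm hj, Finsupp.single_apply]
    · rfl
  · simp

end

/-! ### The linearized normalization problem -/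

/-- The weights of the variables `z` and `w`. -/
def holWeight (n : ℕ) : Fin n ⊕ Unit → ℕ := Sum.elim (fun _ => 1) (fun _ => 2)

theorem weight_holIndex (I : Fin n →₀ ℕ) (k : ℕ) :
    Finsupp.weight (holWeight n) (holIndex I k) = I.degree + 2 * k := by
  rw [Finsupp.degree_eq_weight_one, Finsupp.weight_apply, Finsupp.weight_apply, holIndex,
    Finsupp.sum_sumElim]
  simp [holWeight, Finsupp.sum_single_index, mul_comm, Function.comp_def]

/-- The formal power series in `(z, w)` with coefficient `c I k` at `z^I w^k`. -/
noncomputable def holOf (c : (Fin n →₀ ℕ) → ℕ → ℂ) : HolSeries n :=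
  ofCoeff fun d => c (d.comapDomain Sum.inl Sum.inl_injective.injOn) (d (Sum.inr ()))

theorem coeff_holOf (c : (Fin n →₀ ℕ) → ℕ → ℂ) (I : Fin n →₀ ℕ) (k : ℕ) :
    coeff (holIndex I k) (holOf c) = c I k := by
  simp [holOf, holIndex]

theorem mem_orderIdeal_holWeight {f : HolSeries n} {t : ℕ} :
    f ∈ orderIdeal (holWeight n) t ↔ ∀ I k, I.degree + 2 * k < t → coeff (holIndex I k) f = 0 := by
  rw [mem_orderIdeal]
  constructor
  · intro h I k hk
    exact h _ (by rwa [weight_holIndex])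
  · intro h d hd
    obtain ⟨I, k, rfl⟩ := exists_holIndex d
    exact h I k (by rwa [weight_holIndex] at hd)

/-- The coefficient of `z^I z̄^J u^{k_1} v_2^{k_2} ⋯ v_n^{k_n}` in the expansion of `ψ`. -/
noncomputable abbrev uvCoeff (ψ : RealSeries n) (I J K : Fin n →₀ ℕ) : ℂ :=
  coeff K (expCoeff ψ I J)

theorem uvCoeff_congr {ψ ψ' : RealSeries n} {t : ℕ} (h : ψ - ψ' ∈ orderIdeal 1 t)
    {I J K : Fin n →₀ ℕ} (ht : I.degree + J.degree + 2 * K.degree < t) :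
    uvCoeff ψ I J K = uvCoeff ψ' I J K := by
  have := coeff_expCoeff_eq_zero h ht
  rwa [expCoeff_sub, map_sub, sub_eq_zero] at this

theorem expCoeff_zero (I J : Fin n →₀ ℕ) : expCoeff 0 I J = 0 := by
  have := expCoeff_sub 0 0 I J
  simpa using this

@[simp]
theorem uvCoeff_zero (I J K : Fin n →₀ ℕ) : uvCoeff 0 I J K = 0 := by
  rw [uvCoeff, expCoeff_zero, coeff_zero]

section

variable [NeZero n]

/-- The coefficient of `z^I u^k y_j` in `∑ z̄_h f_h(z, u)`, where `y = (u, v_2, …, v_n)` and `f` is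
the solution `solF` of the linearized problem. -/
noncomputable def betaCoeff (ψ : RealSeries n) (I : Fin n →₀ ℕ) (j : Fin n) (k : ℕ) : ℂ :=
  if I = 0 then if j = 0 then 0 else (((uvCoeff ψ 0 0 (k • e 0 + e j)).re / 2 : ℝ) : ℂ)
  else starRingEnd ℂ (uvCoeff ψ 0 I (k • e 0 + e j))

open Classical in
/-- The change of the `z`-coordinates which normalizes `ψ` to first order. -/
noncomputable def solF (ψ : RealSeries n) (h : Fin n) : HolSeries n := holOf fun I k =>
  if I h = 0 then
    if 2 ≤ I.degree ∨ ∃ i, h < i ∧ I = e i then uvCoeff ψ I (e h) (k • e 0) else 0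
  else ∑ j, uvMatrix n j h * betaCoeff ψ (I - e h) j k

/-- The change of the `w`-coordinate which normalizes `ψ` to first order. -/
noncomputable def solG (ψ : RealSeries n) : HolSeries n := holOf fun I k =>
  if I = 0 then -uvCoeff ψ 0 0 (k • e 0)
  else starRingEnd ℂ (uvCoeff ψ 0 I (k • e 0)) - uvCoeff ψ I 0 (k • e 0)

/-- The series `∑ z̄_h f_h(z, u)`. -/
noncomputable def hermPart (f : Fin n → HolSeries n) : RealSeries n :=
  ∑ h, zbarVar h * restrict (normSq n) (f h)

/-- The normal form of `ψ` with respect to the linearized problem. -/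
noncomputable def solPhi (ψ : RealSeries n) : RealSeries n :=
  ψ + restrict (normSq n) (solG ψ) - hermPart (solF ψ) - conj (hermPart (solF ψ))

theorem expCoeff_solPhi (ψ : RealSeries n) {I J : Fin n →₀ ℕ} (hIJ : ∀ k, I k * J k = 0) :
    expCoeff (solPhi ψ) I J = expCoeff ψ I J + (if J = 0 then holCoeff (solG ψ) I else 0) -
      expCoeff (hermPart (solF ψ)) I J -
      MvPowerSeries.map (starRingEnd ℂ) (expCoeff (hermPart (solF ψ)) J I) := by
  rw [solPhi, expCoeff_sub, expCoeff_sub, expCoeff_add, expCoeff_conj,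
    expCoeff_restrict_normSq _ hIJ]

theorem expCoeff_hermPart_zero (ψ : RealSeries n) (I : Fin n →₀ ℕ) :
    expCoeff (hermPart (solF ψ)) I 0 = ∑ j, X j * uSeries (betaCoeff ψ I j) := by
  refine expCoeff_sum_zbarVar_mul_restrict _ I _ fun h k => ?_
  rw [solF, coeff_holOf, if_neg (by simp), add_tsub_cancel_right]

theorem expCoeff_hermPart_e (f : Fin n → HolSeries n) (I : Fin n →₀ ℕ) (h : Fin n)
    (hI : I h = 0) : expCoeff (hermPart f) I (e h) = holCoeff (f h) I := by
  have hIJ : ∀ k, I k * (e h) k = 0 := by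
    intro k
    by_cases hk : k = h
    · subst hk; simp [hI]
    · simp [hk]
  rw [hermPart, expCoeff_sum, Finset.sum_eq_single h]
  · rw [expCoeff_zbarVar_mul_restrict _ _ hIJ (by simp), if_pos rfl]
  · intro i _ hi
    rw [expCoeff_zbarVar_mul_restrict _ _ hIJ (by simp), if_neg]
    intro h'
    exact hi (Finsupp.single_left_injective one_ne_zero h').symm
  · simp

theorem expCoeff_hermPart_of_ne (f : Fin n → HolSeries n) {I J : Fin n →₀ ℕ}
    (hIJ : ∀ k, I k * J k = 0) (hJ : J ≠ 0) (hJe : ∀ h, J ≠ e h) :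
    expCoeff (hermPart f) I J = 0 := by
  rw [hermPart, expCoeff_sum]
  refine Finset.sum_eq_zero fun i _ => ?_
  rw [expCoeff_zbarVar_mul_restrict _ _ hIJ hJ, if_neg (hJe i)]

theorem holCoeff_solF_zero (ψ : RealSeries n) (h : Fin n) : holCoeff (solF ψ h) 0 = 0 := by
  ext K
  rw [holCoeff, uSeries, coeff_ofCoeff]
  split_ifs
  · rw [solF, coeff_holOf, if_pos (by simp), if_neg, coeff_zero]
    rintro (h' | ⟨i, -, hi⟩)
    · simp at h'
    · simp [eq_comm] at hi
  · simp

/-- Since `f_h` has no pure powers of `w`, `∑ z̄_h f_h` does not touch the terms with `I = 0`, `J ≠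
0`. These are reached by its conjugate alone, so the conditions decouple. -/
theorem expCoeff_hermPart_zero_left (ψ : RealSeries n) {J : Fin n →₀ ℕ} (hJ : J ≠ 0) :
    expCoeff (hermPart (solF ψ)) 0 J = 0 := by
  by_cases hJe : ∃ h, J = e h
  · obtain ⟨h, rfl⟩ := hJe
    rw [expCoeff_hermPart_e _ _ _ (by simp), holCoeff_solF_zero]
  · exact expCoeff_hermPart_of_ne _ (by simp) hJ fun h hh => hJe ⟨h, hh⟩

theorem coeff_holCoeff (g : HolSeries n) (I : Fin n →₀ ℕ) (k : ℕ) :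
    coeff (k • e 0) (holCoeff g I) = coeff (holIndex I k) g :=
  coeff_uSeries _ _

theorem uvCoeff_solPhi_zero_left (ψ : RealSeries n) {I : Fin n →₀ ℕ} (hI : I ≠ 0)
    (K : Fin n →₀ ℕ) : uvCoeff (solPhi ψ) 0 I K = uvCoeff ψ 0 I K -
      starRingEnd ℂ (coeff K (∑ j, X j * uSeries (betaCoeff ψ I j))) := by
  rw [uvCoeff, expCoeff_solPhi ψ (by simp), expCoeff_hermPart_zero_left ψ hI,
    expCoeff_hermPart_zero]
  simp only [if_neg hI, add_zero, sub_zero, map_sub, coeff_map]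

theorem uvCoeff_solPhi_zero_right (ψ : RealSeries n) {I : Fin n →₀ ℕ} (hI : I ≠ 0) (k : ℕ) :
    uvCoeff (solPhi ψ) I 0 (k • e 0) = starRingEnd ℂ (uvCoeff ψ 0 I (k • e 0)) -
      coeff (k • e 0) (∑ j, X j * uSeries (betaCoeff ψ I j)) := by
  rw [uvCoeff, expCoeff_solPhi ψ (by simp), expCoeff_hermPart_zero_left ψ hI,
    expCoeff_hermPart_zero]
  simp only [if_true, map_sub, map_add, coeff_holCoeff, map_zero, sub_zero]
  rw [solG, coeff_holOf, if_neg hI]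
  ring

theorem uvCoeff_solPhi_zero_zero (ψ : RealSeries n) (K : Fin n →₀ ℕ) :
    uvCoeff (solPhi ψ) 0 0 K = uvCoeff ψ 0 0 K + coeff K (holCoeff (solG ψ) 0) -
      coeff K (∑ j, X j * uSeries (betaCoeff ψ 0 j)) -
      starRingEnd ℂ (coeff K (∑ j, X j * uSeries (betaCoeff ψ 0 j))) := by
  rw [uvCoeff, expCoeff_solPhi ψ (by simp), expCoeff_hermPart_zero]
  simp only [if_true, map_sub, map_add, coeff_map]

theorem succ_smul_e (k : ℕ) : (k + 1) • e (0 : Fin n) = k • e 0 + e 0 := succ_nsmul _ _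

/-- Each family of unknowns serves one group of conditions. The terms of `f_h` free of `z_h` give
`bilinear` and `mixed`. The others, through `betaCoeff`, give `linear_v`, `antihol_u` and
`antihol_v`. The series `g` gives `pure_u` and, together with `betaCoeff`, `hol_u` and `harmonic`.
-/
theorem normalizedCoeffs_solPhi (ψ : RealSeries n) : NormalizedCoeffs (uvCoeff (solPhi ψ)) where
  pure_u τ hτ := by
    obtain ⟨k, rfl⟩ : ∃ k, τ = k + 1 := ⟨τ - 1, by omega⟩
    rw [uvCoeff_solPhi_zero_zero, coeff_holCoeff, solG, coeff_holOf, if_pos rfl, succ_smul_e,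
      coeff_sum_X_mul_uSeries]
    simp [betaCoeff]
  linear_v l hl i hi := by
    rw [uvCoeff_solPhi_zero_zero, coeff_sum_X_mul_uSeries, holCoeff,
      coeff_uSeries_of_ne_zero _ hi (by simp), betaCoeff, if_pos rfl, if_neg hi,
      Complex.conj_ofReal, Complex.sub_re, Complex.sub_re, Complex.add_re, Complex.ofReal_re,
      Complex.zero_re]
    ring
  bilinear l hl i j hij := by
    have hij' : ∀ k, (e i) k * (e j) k = 0 := by
      intro k
      by_cases hk : k = i
      · subst hk; simp [hij.ne']
      · simp [hk]
    rw [uvCoeff, expCoeff_solPhi ψ hij', expCoeff_hermPart_e _ _ _ (by simp [hij.ne]),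
      expCoeff_hermPart_e _ _ _ (by simp [hij.ne'])]
    simp only [map_sub, map_add, coeff_map, coeff_holCoeff]
    rw [if_neg (by simp), solF, coeff_holOf, if_pos (by simp [hij.ne]),
      if_pos (Or.inr ⟨i, hij, rfl⟩), solF, coeff_holOf, if_pos (by simp [hij.ne']), if_neg]
    -- Only one of the two contributions is nonzero: `f_j` contains the term `z_i w^l` for `j < i`,
    -- while `f_i` does not contain `z_j w^l`.
    · simp
    · rintro (h | ⟨i', hi', h⟩)
      · simp at h
      · have := Finsupp.single_left_injective one_ne_zero h
        subst this
        exact absurd hij (not_lt.2 hi'.le)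
  hol_u l hl I hI := by
    have hI0 : I ≠ 0 := by rintro rfl; simp at hI
    obtain ⟨k, rfl⟩ : ∃ k, l = k + 1 := ⟨l - 1, by omega⟩
    rw [uvCoeff_solPhi_zero_right ψ hI0, succ_smul_e, coeff_sum_X_mul_uSeries, betaCoeff,
      if_neg hI0, sub_self]
  antihol_u l hl I hI := by
    have hI0 : I ≠ 0 := by rintro rfl; simp at hI
    obtain ⟨k, rfl⟩ : ∃ k, l = k + 1 := ⟨l - 1, by omega⟩
    rw [uvCoeff_solPhi_zero_left ψ hI0, succ_smul_e, coeff_sum_X_mul_uSeries, betaCoeff,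
      if_neg hI0, Complex.conj_conj, sub_self]
  antihol_v k j I hI := by
    have hI0 : I ≠ 0 := by rintro rfl; simp at hI
    rw [uvCoeff_solPhi_zero_left ψ hI0, coeff_sum_X_mul_uSeries, betaCoeff,
      if_neg hI0, Complex.conj_conj, sub_self]
  mixed k h I hI hh := by
    have hIJ : ∀ k, I k * (e h) k = 0 := by
      intro k
      by_cases hk : k = h
      · subst hk; simp [hh]
      · simp [hk]
    rw [uvCoeff, expCoeff_solPhi ψ hIJ, expCoeff_hermPart_e _ _ _ hh,
      expCoeff_hermPart_of_ne _ (fun k => by rw [mul_comm]; exact hIJ k)]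
    · simp only [map_sub, map_add, coeff_map, coeff_holCoeff]
      rw [if_neg (by simp), solF, coeff_holOf, if_pos hh, if_pos (Or.inl hI)]
      simp
    · rintro rfl; simp at hI
    · rintro i rfl; simp at hI
  harmonic I hI := by
    have hI0 : I ≠ 0 := by rintro rfl; simp at hI
    -- At `K = 0` the `betaCoeff` contribution vanishes, because each of its terms carries a factor
    -- `y_j`. What remains are the conjugate value set by `g` and the unchanged coefficient of `ψ`.
    have := uvCoeff_solPhi_zero_right ψ hI0 0
    simp only [zero_smul] at this
    rw [this, uvCoeff_solPhi_zero_left ψ hI0, coeff_zero_sum_X_mul]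
    simp

/-- One order is lost because `f_h` enters multiplied by `z̄_h`. -/
theorem solF_sub_mem {ψ ψ' : RealSeries n} {t : ℕ} (h : ψ - ψ' ∈ orderIdeal 1 (t + 1))
    (i : Fin n) : solF ψ i - solF ψ' i ∈ orderIdeal (holWeight n) t := by
  rw [mem_orderIdeal_holWeight]
  intro I k hk
  rw [map_sub, sub_eq_zero, solF, coeff_holOf, solF, coeff_holOf]
  by_cases hI : I i = 0
  · rw [if_pos hI, if_pos hI, uvCoeff_congr h]
    simp; omega
  · rw [if_neg hI, if_neg hI]
    have hle : e i ≤ I := by rw [e, Finsupp.single_le_iff]; omega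
    have hdeg : (I - e i).degree + 1 = I.degree := by
      conv_rhs => rw [← tsub_add_cancel_of_le hle]
      simp
    refine Finset.sum_congr rfl fun j _ => ?_
    rw [betaCoeff, betaCoeff, uvCoeff_congr h, uvCoeff_congr h]
    · simp; omega
    · simp; omega

theorem solG_sub_mem {ψ ψ' : RealSeries n} {t : ℕ} (h : ψ - ψ' ∈ orderIdeal 1 t) :
    solG ψ - solG ψ' ∈ orderIdeal (holWeight n) t := by
  rw [mem_orderIdeal_holWeight]
  intro I k hk
  rw [map_sub, sub_eq_zero, solG, coeff_holOf, solG, coeff_holOf, uvCoeff_congr h,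
    uvCoeff_congr h, uvCoeff_congr h]
  all_goals simp; omega

theorem solF_zero (i : Fin n) : solF (0 : RealSeries n) i = 0 := by
  ext d
  obtain ⟨I, k, rfl⟩ := exists_holIndex d
  simp [solF, coeff_holOf, betaCoeff]

theorem solG_zero : solG (0 : RealSeries n) = 0 := by
  ext d
  obtain ⟨I, k, rfl⟩ := exists_holIndex d
  simp [solG, coeff_holOf]

end

/-! ### The nonlinear equation and the existence of pseudo-normal forms -/

theorem normSq_mem_orderIdeal : normSq n ∈ orderIdeal 1 2 := by
  refine sum_mem fun k _ => ?_
  exact mul_mem_orderIdeal (s := 1) (t := 1) (X_mem_orderIdeal 1 _) (X_mem_orderIdeal 1 _)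

theorem constantCoeff_eq_zero_of_mem {σ : Type*} {f : MvPowerSeries σ ℂ} {t : ℕ}
    (hf : f ∈ orderIdeal 1 t) (ht : 1 ≤ t) : constantCoeff f = 0 :=
  mem_orderIdeal_one_one.1 (orderIdeal_mono ht hf)

section

variable {Φ : RealSeries n}

theorem elim_zVar_mem (hΦ : Φ ∈ orderIdeal 1 2) (s : Fin n ⊕ Unit) :
    (Sum.elim zVar (fun _ => Φ) s : RealSeries n) ∈ orderIdeal 1 (holWeight n s) := by
  rcases s with k | k
  · exact X_mem_orderIdeal 1 _
  · exact hΦ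

theorem hasSubst_restrict (hΦ : Φ ∈ orderIdeal 1 2) :
    HasSubst (Sum.elim zVar (fun _ => Φ) : Fin n ⊕ Unit → RealSeries n) :=
  hasSubst_elim_zVar (constantCoeff_eq_zero_of_mem hΦ (by norm_num))

theorem restrict_mem_orderIdeal (hΦ : Φ ∈ orderIdeal 1 2) {h : HolSeries n} {t : ℕ}
    (hh : h ∈ orderIdeal (holWeight n) t) : restrict Φ h ∈ orderIdeal 1 t :=
  subst_mem_orderIdeal (hasSubst_restrict hΦ) (elim_zVar_mem hΦ) hh

theorem restrict_add (hΦ : Φ ∈ orderIdeal 1 2) (f g : HolSeries n) :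
    restrict Φ (f + g) = restrict Φ f + restrict Φ g :=
  subst_add (hasSubst_restrict hΦ) _ _

theorem restrict_sub (hΦ : Φ ∈ orderIdeal 1 2) (f g : HolSeries n) :
    restrict Φ (f - g) = restrict Φ f - restrict Φ g :=
  subst_sub (hasSubst_restrict hΦ) _ _

theorem restrict_sub_restrict_normSq_mem (hΦ : Φ ∈ orderIdeal 1 2)
    (hΦ' : Φ - normSq n ∈ orderIdeal 1 3) {h : HolSeries n} {t : ℕ}
    (hh : h ∈ orderIdeal (holWeight n) t) :
    restrict Φ h - restrict (normSq n) h ∈ orderIdeal 1 (t + 1) := by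
  refine subst_sub_subst_mem_orderIdeal (hasSubst_restrict hΦ)
    (hasSubst_restrict normSq_mem_orderIdeal) (elim_zVar_mem hΦ)
    (elim_zVar_mem normSq_mem_orderIdeal) ?_ hh
  rintro (k | k)
  · simp
  · exact hΦ'

end

theorem hermPart_sub_mem {f g : Fin n → HolSeries n} {t : ℕ}
    (h : ∀ i, f i - g i ∈ orderIdeal (holWeight n) t) :
    hermPart f - hermPart g ∈ orderIdeal 1 (t + 1) := by
  rw [hermPart, hermPart, ← Finset.sum_sub_distrib]
  refine sum_mem fun i _ => ?_
  rw [← mul_sub, ← restrict_sub normSq_mem_orderIdeal, add_comm]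
  exact mul_mem_orderIdeal (X_mem_orderIdeal 1 _)
    (restrict_mem_orderIdeal normSq_mem_orderIdeal (h i))

theorem restrict_zero (Φ : RealSeries n) (hΦ : Φ ∈ orderIdeal 1 2) : restrict Φ 0 = 0 := by
  simpa using restrict_sub hΦ 0 0

theorem conj_zero : conj (0 : RealSeries n) = 0 := by
  simpa using conj_sub (0 : RealSeries n) 0

theorem hermPart_zero : hermPart (fun _ => 0 : Fin n → HolSeries n) = 0 := by
  simp [hermPart, restrict_zero _ normSq_mem_orderIdeal]

/-- The substitution `(z, z̄) ↦ (F, F̄)`. -/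
noncomputable abbrev elimConj (F : Fin n → RealSeries n) : Fin n ⊕ Fin n → RealSeries n :=
  Sum.elim F fun k => conj (F k)

theorem elimConj_mem {F : Fin n → RealSeries n} {t : ℕ} (h : ∀ k, F k ∈ orderIdeal 1 t)
    (s : Fin n ⊕ Fin n) : elimConj F s ∈ orderIdeal 1 t := by
  rcases s with k | k
  · exact h k
  · exact conj_mem_orderIdeal (h k)

theorem elimConj_sub_mem {F G : Fin n → RealSeries n} {t : ℕ}
    (h : ∀ k, F k - G k ∈ orderIdeal 1 t)
    (s : Fin n ⊕ Fin n) : elimConj F s - elimConj G s ∈ orderIdeal 1 t := by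
  rcases s with k | k
  · exact h k
  · rw [elimConj, elimConj, Sum.elim_inr, Sum.elim_inr, ← conj_sub]
    exact conj_mem_orderIdeal (h k)

theorem hasSubst_elimConj {F : Fin n → RealSeries n} (h : ∀ k, F k ∈ orderIdeal 1 1) :
    HasSubst (elimConj F) :=
  hasSubst_elim_conj fun k => mem_orderIdeal_one_one.1 (h k)

theorem elimConj_zVar : elimConj (zVar : Fin n → RealSeries n) = X := by
  simp only [elimConj, conj_zVar, elim_zVar_zbarVar]

theorem zVar_mem (k : Fin n) : (zVar k : RealSeries n) ∈ orderIdeal 1 1 :=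
  X_mem_orderIdeal 1 _

theorem subst_elimConj_sub_mem {F G : Fin n → RealSeries n} {e t : ℕ}
    (hF : ∀ k, F k ∈ orderIdeal 1 1) (hG : ∀ k, G k ∈ orderIdeal 1 1)
    (hFG : ∀ k, F k - G k ∈ orderIdeal 1 (1 + e)) {f : RealSeries n} (hf : f ∈ orderIdeal 1 t) :
    subst (elimConj F) f - subst (elimConj G) f ∈ orderIdeal 1 (t + e) :=
  subst_sub_subst_mem_orderIdeal (w := 1) (hasSubst_elimConj hF) (hasSubst_elimConj hG)
    (elimConj_mem hF) (elimConj_mem hG) (elimConj_sub_mem hFG) hf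

theorem restrict_sub_restrict_diff_mem {Φ : RealSeries n} (hΦ : Φ ∈ orderIdeal 1 2)
    (hΦ' : Φ - normSq n ∈ orderIdeal 1 3) {f g : HolSeries n} {t : ℕ}
    (h : f - g ∈ orderIdeal (holWeight n) t) :
    (restrict Φ f - restrict (normSq n) f) - (restrict Φ g - restrict (normSq n) g) ∈
      orderIdeal 1 (t + 1) := by
  have := restrict_sub_restrict_normSq_mem hΦ hΦ' h
  rw [restrict_sub hΦ, restrict_sub normSq_mem_orderIdeal] at this
  rwa [sub_sub_sub_comm]

theorem normSq_add_mem {E : RealSeries n} (hE : E ∈ orderIdeal 1 3) :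
    normSq n + E ∈ orderIdeal 1 2 :=
  add_mem normSq_mem_orderIdeal (orderIdeal_mono (by norm_num) hE)

theorem subst_elimConj_normSq {F : Fin n → RealSeries n} (h : ∀ k, F k ∈ orderIdeal 1 1) :
    subst (elimConj F) (normSq n) = ∑ k, F k * conj (F k) := by
  have hs := hasSubst_elimConj h
  rw [normSq, subst_finset_sum hs]
  refine Finset.sum_congr rfl fun k _ => ?_
  rw [absSq, subst_mul hs, zVar, zbarVar, subst_X hs, subst_X hs]
  rfl

/-- Weight 2 still permits a term linear in `w` in `f`, but no term linear in `z`. The Jacobian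
matrix is therefore block unitriangular. -/
theorem isFormalChange_add {f : Fin n → HolSeries n} {g : HolSeries n}
    (hf : ∀ i, f i ∈ orderIdeal (holWeight n) 2) (hg : g ∈ orderIdeal (holWeight n) 3) :
    IsFormalChange (Sum.elim (fun i => X (Sum.inl i) + f i) fun _ => X (Sum.inr ()) + g) := by
  classical
  have hf0 : ∀ i, constantCoeff (f i) = 0 := fun i => by
    simpa using hf i 0 (by simp)
  have hg0 : constantCoeff g = 0 := by simpa using hg 0 (by simp)
  have hf1 : ∀ i j, coeff (Finsupp.single (Sum.inl j) 1) (f i) = 0 := fun i j =>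
    hf i _ (by simp [Finsupp.weight_single, holWeight])
  have hg1 : ∀ b, coeff (Finsupp.single b 1) g = 0 := fun b =>
    hg _ (by rcases b with b | b <;> simp [Finsupp.weight_single, holWeight])
  refine ⟨?_, ?_⟩
  · rintro (i | i)
    · simp [hf0]
    · simp [hg0]
  · have : (Matrix.of fun a b : Fin n ⊕ Unit => coeff (Finsupp.single b 1)
        ((Sum.elim (fun i => X (Sum.inl i) + f i) fun _ => X (Sum.inr ()) + g :
          FormalMap n) a)) =
        Matrix.fromBlocks 1 (Matrix.of fun i _ => coeff (Finsupp.single (Sum.inr ()) 1) (f i))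
          0 1 := by
      ext a b
      rcases a with a | a <;> rcases b with b | b <;>
        simp [hf1, hg1, coeff_index_single_X, Matrix.one_apply, eq_comm]
    rw [this, Matrix.det_fromBlocks_zero₂₁]
    simp

section

variable [NeZero n]

theorem solPhi_sub_mem {ψ ψ' : RealSeries n} {t : ℕ} (h : ψ - ψ' ∈ orderIdeal 1 (t + 1)) :
    solPhi ψ - solPhi ψ' ∈ orderIdeal 1 (t + 1) := by
  have h1 := restrict_mem_orderIdeal normSq_mem_orderIdeal (solG_sub_mem h)
  rw [restrict_sub normSq_mem_orderIdeal] at h1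
  have h2 := hermPart_sub_mem (solF_sub_mem h)
  have h3 := conj_mem_orderIdeal h2
  rw [conj_sub] at h3
  have : solPhi ψ - solPhi ψ' = (ψ - ψ') +
      (restrict (normSq n) (solG ψ) - restrict (normSq n) (solG ψ')) -
      (hermPart (solF ψ) - hermPart (solF ψ')) -
      (conj (hermPart (solF ψ)) - conj (hermPart (solF ψ'))) := by
    simp only [solPhi]; ring
  rw [this]
  exact sub_mem (sub_mem (add_mem h h1) h2) h3

theorem solPhi_zero : solPhi (0 : RealSeries n) = 0 := by
  have : solF (0 : RealSeries n) = fun _ => 0 := funext solF_zero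
  rw [solPhi, this, solG_zero, hermPart_zero, restrict_zero _ normSq_mem_orderIdeal, conj_zero]
  simp

theorem solF_mem {ψ : RealSeries n} (h : ψ ∈ orderIdeal 1 3) (i : Fin n) :
    solF ψ i ∈ orderIdeal (holWeight n) 2 := by
  simpa [solF_zero] using solF_sub_mem (ψ' := 0) (t := 2) (by simpa using h) i

theorem solG_mem {ψ : RealSeries n} (h : ψ ∈ orderIdeal 1 3) :
    solG ψ ∈ orderIdeal (holWeight n) 3 := by
  have := solG_sub_mem (ψ := ψ) (ψ' := 0) (t := 3) (by simpa using h)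
  rwa [solG_zero, sub_zero] at this

theorem solPhi_mem {ψ : RealSeries n} (h : ψ ∈ orderIdeal 1 3) :
    solPhi ψ ∈ orderIdeal 1 3 := by
  have := solPhi_sub_mem (ψ := ψ) (ψ' := 0) (t := 2) (by simpa using h)
  rwa [solPhi_zero, sub_zero] at this

/-- The restriction of the `z`-component `z_i + f_i` of the coordinate change to `w = Φ`. -/
noncomputable def newZ (Φ ψ : RealSeries n) (i : Fin n) : RealSeries n :=
  zVar i + restrict Φ (solF ψ i)

theorem newZ_sub_zVar_mem {Φ ψ : RealSeries n} (hΦ : Φ ∈ orderIdeal 1 2)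
    (hψ : ψ ∈ orderIdeal 1 3) (i : Fin n) : newZ Φ ψ i - zVar i ∈ orderIdeal 1 2 := by
  rw [newZ, add_sub_cancel_left]
  exact restrict_mem_orderIdeal hΦ (solF_mem hψ i)

theorem newZ_mem {Φ ψ : RealSeries n} (hΦ : Φ ∈ orderIdeal 1 2)
    (hψ : ψ ∈ orderIdeal 1 3) (i : Fin n) : newZ Φ ψ i ∈ orderIdeal 1 1 := by
  rw [← sub_add_cancel (newZ Φ ψ i) (zVar i)]
  exact add_mem (orderIdeal_mono (by norm_num) (newZ_sub_zVar_mem hΦ hψ i)) (zVar_mem i)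

theorem newZ_sub_newZ_mem {Φ ψ ψ' : RealSeries n} (hΦ : Φ ∈ orderIdeal 1 2) {t : ℕ}
    (hψ : ψ - ψ' ∈ orderIdeal 1 (t + 1)) (i : Fin n) :
    newZ Φ ψ i - newZ Φ ψ' i ∈ orderIdeal 1 t := by
  rw [newZ, newZ, add_sub_add_left_eq_sub, ← restrict_sub hΦ]
  exact restrict_mem_orderIdeal hΦ (solF_sub_mem hψ i)

/-- The difference `f(F, F̄) - f(z, z̄)` for `F = z + f(z, Φ)`. -/
noncomputable def substError (Φ ψ : RealSeries n) : RealSeries n :=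
  subst (elimConj (newZ Φ ψ)) (solPhi ψ) - solPhi ψ

theorem substError_sub_mem {Φ ψ ψ' : RealSeries n} (hΦ : Φ ∈ orderIdeal 1 2)
    (hψ : ψ ∈ orderIdeal 1 3) (hψ' : ψ' ∈ orderIdeal 1 3) {t : ℕ}
    (h : ψ - ψ' ∈ orderIdeal 1 (t + 2)) :
    substError Φ ψ - substError Φ ψ' ∈ orderIdeal 1 (t + 3) := by
  -- Both the substituted series and the map depend on `ψ`, so the difference is split. Here the
  -- series varies and the gain is that of `F - z`; in `h2` the map varies and the gain comes from
  -- `solPhi ψ'` having order 3.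
  have h1 : subst (elimConj (newZ Φ ψ)) (solPhi ψ - solPhi ψ') - (solPhi ψ - solPhi ψ') ∈
      orderIdeal 1 (t + 2 + 1) := by
    have := subst_elimConj_sub_mem (e := 1) (newZ_mem hΦ hψ) zVar_mem (newZ_sub_zVar_mem hΦ hψ)
      (solPhi_sub_mem (t := t + 1) h)
    rwa [elimConj_zVar, subst_self] at this
  have h2 : subst (elimConj (newZ Φ ψ)) (solPhi ψ') - subst (elimConj (newZ Φ ψ')) (solPhi ψ') ∈
      orderIdeal 1 (3 + t) :=
    subst_elimConj_sub_mem (newZ_mem hΦ hψ) (newZ_mem hΦ hψ')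
      (fun k => by simpa [add_comm] using newZ_sub_newZ_mem hΦ (t := t + 1) h k) (solPhi_mem hψ')
  rw [subst_sub (hasSubst_elimConj (newZ_mem hΦ hψ))] at h1
  rw [add_comm 3 t] at h2
  have : substError Φ ψ - substError Φ ψ' = (subst (elimConj (newZ Φ ψ)) (solPhi ψ) -
      subst (elimConj (newZ Φ ψ)) (solPhi ψ') - (solPhi ψ - solPhi ψ')) +
      (subst (elimConj (newZ Φ ψ)) (solPhi ψ') - subst (elimConj (newZ Φ ψ')) (solPhi ψ')) := by
    simp only [substError]; ring
  rw [this]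
  exact add_mem h1 h2

/-- The term `∑ z̄_h (f_h(z, Φ) - f_h(z, u))`. -/
noncomputable def hermError (Φ ψ : RealSeries n) : RealSeries n :=
  ∑ h, zbarVar h * (restrict Φ (solF ψ h) - restrict (normSq n) (solF ψ h))

theorem hermError_sub_mem {Φ ψ ψ' : RealSeries n} (hΦ : Φ ∈ orderIdeal 1 2)
    (hΦ' : Φ - normSq n ∈ orderIdeal 1 3) {t : ℕ} (h : ψ - ψ' ∈ orderIdeal 1 (t + 2)) :
    hermError Φ ψ - hermError Φ ψ' ∈ orderIdeal 1 (t + 3) := by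
  rw [hermError, hermError, ← Finset.sum_sub_distrib]
  refine sum_mem fun i _ => ?_
  rw [← mul_sub, add_comm t 3, show 3 + t = 1 + (t + 1 + 1) by omega]
  exact mul_mem_orderIdeal (X_mem_orderIdeal 1 _)
    (restrict_sub_restrict_diff_mem hΦ hΦ' (solF_sub_mem (t := t + 1) h i))

/-- The term `∑ |f_h(z, Φ)|²`. -/
noncomputable def quadError (Φ ψ : RealSeries n) : RealSeries n :=
  ∑ h, restrict Φ (solF ψ h) * conj (restrict Φ (solF ψ h))

theorem quadError_sub_mem {Φ ψ ψ' : RealSeries n} (hΦ : Φ ∈ orderIdeal 1 2)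
    (hψ : ψ ∈ orderIdeal 1 3) (hψ' : ψ' ∈ orderIdeal 1 3)
    {t : ℕ} (h : ψ - ψ' ∈ orderIdeal 1 (t + 2)) :
    quadError Φ ψ - quadError Φ ψ' ∈ orderIdeal 1 (t + 3) := by
  rw [quadError, quadError, ← Finset.sum_sub_distrib]
  refine sum_mem fun i _ => ?_
  have h1 : restrict Φ (solF ψ i) - restrict Φ (solF ψ' i) ∈ orderIdeal 1 (t + 1) := by
    rw [← restrict_sub hΦ]
    exact restrict_mem_orderIdeal hΦ (solF_sub_mem (t := t + 1) h i)
  have h2 := conj_mem_orderIdeal h1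
  have h3 := conj_mem_orderIdeal (restrict_mem_orderIdeal hΦ (solF_mem hψ i))
  have h4 := restrict_mem_orderIdeal hΦ (solF_mem hψ' i)
  have h5 := add_mem (mul_mem_orderIdeal h1 h3)
    (by have := mul_mem_orderIdeal h4 h2; rwa [add_comm 2 (t + 1)] at this)
  rw [conj_sub] at h5
  convert h5 using 1
  ring

/-- The equation `ψ = normalizingMap E ψ` expresses that the coordinate change `(z + f, w + g)`
given by `ψ` maps `w = |z|² + E` to `w = |z|² + φ`, where `φ` is the normal form of `ψ`. -/
noncomputable def normalizingMap (E ψ : RealSeries n) : RealSeries n :=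
  E + (restrict (normSq n + E) (solG ψ) - restrict (normSq n) (solG ψ)) -
    hermError (normSq n + E) ψ - conj (hermError (normSq n + E) ψ) -
    quadError (normSq n + E) ψ - substError (normSq n + E) ψ

theorem exists_normalizingMap_eq {E : RealSeries n} (hE : E ∈ orderIdeal 1 3) :
    ∃ ψ ∈ orderIdeal 1 3, normalizingMap E ψ = ψ := by
  have hΦ := normSq_add_mem hE
  have hΦ' : normSq n + E - normSq n ∈ orderIdeal 1 3 := by simpa using hE
  refine exists_fixed_point _ ?_ ?_
  · have h0 : hermError (normSq n + E) 0 = 0 := by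
      simp [hermError, solF_zero, restrict_zero _ hΦ, restrict_zero _ normSq_mem_orderIdeal]
    have h1 : quadError (normSq n + E) 0 = 0 := by
      simp [quadError, solF_zero, restrict_zero _ hΦ]
    have h2 : substError (normSq n + E) 0 = 0 := by
      have hs := subst_sub (hasSubst_elimConj (newZ_mem hΦ (zero_mem (orderIdeal 1 3))))
        (0 : RealSeries n) 0
      rw [substError, solPhi_zero]
      simpa using hs
    rw [normalizingMap, h0, h1, h2, solG_zero, restrict_zero _ hΦ,
      restrict_zero _ normSq_mem_orderIdeal, conj_zero]
    simpa using hE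
  · intro t ht ψ hψ ψ' hψ' h
    obtain ⟨s, rfl⟩ : ∃ s, t = s + 2 := ⟨t - 2, by omega⟩
    have a1 := restrict_sub_restrict_diff_mem hΦ hΦ' (solG_sub_mem h)
    have a2 := hermError_sub_mem hΦ hΦ' h
    have a3 := conj_mem_orderIdeal a2
    rw [conj_sub] at a3
    have a4 := quadError_sub_mem hΦ hψ hψ' h
    have a5 := substError_sub_mem hΦ hψ hψ' h
    have := sub_mem (sub_mem (sub_mem (sub_mem a1 a2) a3) a4) a5
    convert this using 1
    simp only [normalizingMap]
    ring

theorem exists_isPseudoNormalForm {E : RealSeries n} (hE : E ∈ orderIdeal 1 3) :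
    ∃ φ, IsPseudoNormalForm E φ := by
  obtain ⟨ψ, hψ, hfix⟩ := exists_normalizingMap_eq hE
  have hΦ := normSq_add_mem hE
  refine ⟨solPhi ψ, ⟨mem_orderIdeal_one_iff_le.1 (solPhi_mem hψ), _, isExpansion_expCoeff _,
    normalizedCoeffs_solPhi ψ⟩, _, isFormalChange_add (solF_mem hψ) (solG_mem hψ), ?_⟩
  have hX : ∀ s, restrict (normSq n + E) (X s) = Sum.elim zVar (fun _ => normSq n + E) s :=
    fun s => subst_X (hasSubst_restrict hΦ) s
  simp only [MapsGraph, Sum.elim_inl, Sum.elim_inr, restrict_add hΦ, hX]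
  change _ = subst (elimConj (newZ (normSq n + E) ψ)) _
  have hZ := newZ_mem hΦ hψ
  rw [subst_add (hasSubst_elimConj hZ), subst_elimConj_normSq hZ]
  -- Expansion of `|z + f|²`. The part linear in `f` is split into its value at `w = u` and
  -- `hermError`.
  have hsum : ∑ k, newZ (normSq n + E) ψ k * conj (newZ (normSq n + E) ψ k) =
      normSq n + (hermPart (solF ψ) + hermError (normSq n + E) ψ) +
      conj (hermPart (solF ψ) + hermError (normSq n + E) ψ) + quadError (normSq n + E) ψ := by
    have h1 : hermPart (solF ψ) + hermError (normSq n + E) ψ =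
        ∑ h, zbarVar h * restrict (normSq n + E) (solF ψ h) := by
      rw [hermPart, hermError, ← Finset.sum_add_distrib]
      exact Finset.sum_congr rfl fun _ _ => by ring
    rw [h1, conj_sum, normSq, quadError, ← Finset.sum_add_distrib, ← Finset.sum_add_distrib,
      ← Finset.sum_add_distrib]
    refine Finset.sum_congr rfl fun k _ => ?_
    rw [newZ, conj_add, conj_zVar, conj_mul, conj_zbarVar, absSq]
    ring
  rw [hsum, conj_add]
  have h2 : substError (normSq n + E) ψ = subst (elimConj (newZ (normSq n + E) ψ)) (solPhi ψ) -
    solPhi ψ := rfl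
  have h3 : solPhi ψ = ψ + restrict (normSq n) (solG ψ) - hermPart (solF ψ) -
    conj (hermPart (solF ψ)) := rfl
  rw [normalizingMap] at hfix
  linear_combination hfix + h2 - h3

end

/-! ### Holomorphic series with real-valued restriction -/

theorem conj_C_ofReal (a : ℝ) : conj (C (a : ℂ) : RealSeries n) = C (a : ℂ) := by
  rw [← conjHom_apply]; simp [conjHom]

theorem restrict_C {Φ : RealSeries n} (a : ℂ) : restrict Φ (C a) = C a :=
  subst_C a

theorem restrict_mul {Φ : RealSeries n} (hΦ : Φ ∈ orderIdeal 1 2) (f g : HolSeries n) :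
    restrict Φ (f * g) = restrict Φ f * restrict Φ g :=
  subst_mul (hasSubst_restrict hΦ) _ _

theorem restrict_pow {Φ : RealSeries n} (hΦ : Φ ∈ orderIdeal 1 2) (f : HolSeries n) (k : ℕ) :
    restrict Φ (f ^ k) = restrict Φ f ^ k :=
  subst_pow (hasSubst_restrict hΦ) _ _

theorem isRealValued_restrict_add_mul_pow {Φ : RealSeries n} (hΦ : Φ ∈ orderIdeal 1 2)
    {P G : HolSeries n} (hP : IsRealValued (restrict Φ P)) (hG : IsRealValued (restrict Φ G))
    (a : ℝ) (k : ℕ) : IsRealValued (restrict Φ (P + C (a : ℂ) * G ^ k)) := by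
  rw [IsRealValued] at *
  rw [restrict_add hΦ, restrict_mul hΦ, restrict_pow hΦ, restrict_C, conj_add, conj_mul,
    conj_C_ofReal, hP, ← conjHom_apply (_ ^ k), map_pow, conjHom_apply, hG]

theorem pow_sub_pow_mem_orderIdeal {σ : Type*} {w : σ → ℕ} {s : ℕ} {f g : MvPowerSeries σ ℂ}
    (hf : f ∈ orderIdeal w s) (hg : g ∈ orderIdeal w s) (hfg : f - g ∈ orderIdeal w (s + 1))
    (k : ℕ) : f ^ k - g ^ k ∈ orderIdeal w (k * s + 1) := by
  have := (prod_pow_sub_prod_pow_mem (w := fun _ : Unit => s) (v := w) (e := 1)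
    (a := fun _ => f) (b := fun _ => g) (fun _ => hf) (fun _ => hg) (fun _ => hfg)
    (Finsupp.single () k)).2.2
  simpa [Finsupp.weight_single, Finsupp.prod_single_index] using this

/-- Subtracting a multiple of a power of `G = d w + ⋯` raises the weighted order of a series whose
leading part is a multiple of a power of `w`. -/
theorem exists_sub_mul_pow_mem {G Q : HolSeries n} {d : ℝ} (hd : d ≠ 0)
    (hG : G - C (d : ℂ) * X (Sum.inr ()) ∈ orderIdeal (holWeight n) 3) {t : ℕ}
    (hQ : Q ∈ orderIdeal (holWeight n) t)
    (hQ0 : ∀ I k, I.degree + 2 * k = t → I ≠ 0 → coeff (holIndex I k) Q = 0)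
    (hQr : ∀ k, 2 * k = t →
      starRingEnd ℂ (coeff (holIndex 0 k) Q) = coeff (holIndex 0 k) Q) :
    ∃ a : ℝ, Q - C (a : ℂ) * G ^ (t / 2) ∈ orderIdeal (holWeight n) (t + 1) := by
  classical
  by_cases ht : ∃ k, 2 * k = t
  · obtain ⟨k, rfl⟩ := ht
    obtain ⟨q, hq⟩ := Complex.conj_eq_iff_real.1 (hQr k rfl)
    rw [Nat.mul_div_cancel_left k two_pos]
    -- The leading part of `Q` is `q w^k`, and that of `G^k` is `d^k w^k`.
    refine ⟨q / d ^ k, ?_⟩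
    have hW : (C (d : ℂ) * X (Sum.inr ()) : HolSeries n) ∈ orderIdeal (holWeight n) 2 :=
      Ideal.mul_mem_left _ _ (X_mem_orderIdeal (holWeight n) (Sum.inr ()))
    have hG2 : G ∈ orderIdeal (holWeight n) 2 := by
      have := add_mem (orderIdeal_mono (by norm_num) hG) hW
      rwa [sub_add_cancel] at this
    have h1 := pow_sub_pow_mem_orderIdeal hG2 hW hG k
    rw [mul_comm k 2] at h1
    have h2 : Q - C (((q / d ^ k : ℝ) : ℂ)) * (C (d : ℂ) * X (Sum.inr ())) ^ k ∈
        orderIdeal (holWeight n) (2 * k + 1) := by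
      have hC : C (((q / d ^ k : ℝ) : ℂ)) * (C (d : ℂ) * X (Sum.inr ())) ^ k =
          (monomial (holIndex 0 k) (q : ℂ) : HolSeries n) := by
        rw [mul_pow, ← map_pow, ← mul_assoc, ← map_mul, X_pow_eq, ← monomial_zero_eq_C_apply,
          monomial_mul_monomial, holIndex, Finsupp.sumElim_zero_single, zero_add, mul_one]
        congr 1
        push_cast
        exact div_mul_cancel₀ _ (pow_ne_zero _ (by exact_mod_cast hd))
      rw [hC, mem_orderIdeal_holWeight]
      intro I j hj
      rw [map_sub, coeff_monomial]
      by_cases hI : I = 0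
      · subst hI
        by_cases hjk : j = k
        · subst hjk
          rw [if_pos rfl, hq, sub_self]
        · rw [if_neg, sub_zero]
          · refine mem_orderIdeal_holWeight.1 hQ _ _ ?_
            simp at hj ⊢; omega
          · intro h
            exact hjk (by simpa [holIndex] using DFunLike.congr_fun h (Sum.inr ()))
      · rw [if_neg, sub_zero]
        · rcases Nat.lt_or_ge (I.degree + 2 * j) (2 * k) with h | h
          · exact mem_orderIdeal_holWeight.1 hQ _ _ h
          · exact hQ0 I j (by omega) hI
        · intro h
          refine hI (Finsupp.ext fun i => ?_)
          simpa [holIndex] using DFunLike.congr_fun h (Sum.inl i)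
    have h3 := sub_mem h2 (Ideal.mul_mem_left _ (C (((q / d ^ k : ℝ) : ℂ))) h1)
    convert h3 using 1
    ring
  -- In odd weight no power of `w` occurs, so the leading part already vanishes. The rounded
  -- exponent `t / 2` is harmless because `a = 0`.
  · refine ⟨0, ?_⟩
    rw [Complex.ofReal_zero, map_zero, zero_mul, sub_zero, mem_orderIdeal_holWeight]
    intro I k hk
    rcases Nat.lt_or_ge (I.degree + 2 * k) t with h | h
    · exact mem_orderIdeal_holWeight.1 hQ _ _ h
    · refine hQ0 I k (by omega) ?_
      rintro rfl
      exact ht ⟨k, by simp at hk h; omega⟩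

/-- Replacing `Φ` by `|z|²` does not affect the leading part of a restriction, so reality to leading
order can be tested on the quadric. -/
theorem restrict_normSq_sub_conj_mem {Φ : RealSeries n} (hΦ : Φ ∈ orderIdeal 1 2)
    (hΦ' : Φ - normSq n ∈ orderIdeal 1 3) {Q : HolSeries n} {t : ℕ}
    (hQ : Q ∈ orderIdeal (holWeight n) t)
    (h : restrict Φ Q - conj (restrict Φ Q) ∈ orderIdeal 1 (t + 1)) :
    restrict (normSq n) Q - conj (restrict (normSq n) Q) ∈ orderIdeal 1 (t + 1) := by
  have h1 := restrict_sub_restrict_normSq_mem hΦ hΦ' hQ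
  have h2 := conj_mem_orderIdeal h1
  rw [conj_sub] at h2
  have h3 := add_mem (sub_mem h h1) h2
  convert h3 using 1
  ring

/-! ### Linear substitutions and leading parts -/

/-- The linear substitution `z ↦ N z`. -/
noncomputable def linZ (N : Matrix (Fin n) (Fin n) ℂ) (k : Fin n) : RealSeries n :=
  ∑ j, N k j • zVar j

theorem linZ_mem (N : Matrix (Fin n) (Fin n) ℂ) (k : Fin n) : linZ N k ∈ orderIdeal 1 1 := by
  refine sum_mem fun j _ => ?_
  rw [smul_eq_C_mul]
  exact Ideal.mul_mem_left _ _ (zVar_mem j)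

theorem hasSubst_linZ (N : Matrix (Fin n) (Fin n) ℂ) : HasSubst (elimConj (linZ N)) :=
  hasSubst_elimConj (linZ_mem N)

theorem subst_linZ_zVar (N : Matrix (Fin n) (Fin n) ℂ) (k : Fin n) :
    subst (elimConj (linZ N)) (zVar k) = linZ N k := by
  rw [zVar, subst_X (hasSubst_linZ N)]; rfl

theorem subst_linZ_linZ {A N : Matrix (Fin n) (Fin n) ℂ} (h : A * N = 1) (k : Fin n) :
    subst (elimConj (linZ N)) (linZ A k) = zVar k := by
  rw [linZ, subst_finset_sum (hasSubst_linZ N)]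
  simp only [subst_smul (hasSubst_linZ N), subst_linZ_zVar, linZ, Finset.smul_sum, smul_smul]
  rw [Finset.sum_comm]
  simp only [← Finset.sum_smul, ← Matrix.mul_apply, h, Matrix.one_apply]
  simp

theorem subst_linZ_mem (N : Matrix (Fin n) (Fin n) ℂ) {f : RealSeries n} {t : ℕ}
    (hf : f ∈ orderIdeal 1 t) : subst (elimConj (linZ N)) f ∈ orderIdeal 1 t :=
  subst_mem_orderIdeal (w := 1) (hasSubst_linZ N) (elimConj_mem (linZ_mem N)) hf

theorem conj_subst_elimConj {F : Fin n → RealSeries n} (hF : ∀ k, F k ∈ orderIdeal 1 1)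
    (f : RealSeries n) : conj (subst (elimConj F) f) = subst (elimConj F) (conj f) :=
  conj_subst_elim (fun k => mem_orderIdeal_one_one.1 (hF k)) f

theorem subst_subst_elimConj {F G : Fin n → RealSeries n} (hF : ∀ k, F k ∈ orderIdeal 1 1)
    (hG : ∀ k, G k ∈ orderIdeal 1 1) (f : RealSeries n) :
    subst (elimConj G) (subst (elimConj F) f) =
      subst (elimConj fun k => subst (elimConj G) (F k)) f := by
  rw [subst_comp_subst_apply (hasSubst_elimConj hF) (hasSubst_elimConj hG)]
  congr 1
  ext1 s
  rcases s with k | k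
  · rfl
  · exact (conj_subst_elimConj hG (F k)).symm

/-- The substitution `(z, w) ↦ (N z, δ w)`. -/
noncomputable def linHol (N : Matrix (Fin n) (Fin n) ℂ) (δ : ℂ) : Fin n ⊕ Unit → HolSeries n :=
  Sum.elim (fun k => ∑ j, N k j • X (Sum.inl j)) (fun _ => C δ * X (Sum.inr ()))

theorem hasSubst_linHol (N : Matrix (Fin n) (Fin n) ℂ) (δ : ℂ) : HasSubst (linHol N δ) :=
  hasSubst_of_constantCoeff_zero (by rintro (k | k) <;> simp [linHol])

theorem restrict_linHol_inl (N : Matrix (Fin n) (Fin n) ℂ) (δ : ℂ) (k : Fin n) :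
    restrict (normSq n) (linHol N δ (Sum.inl k)) = linZ N k := by
  have hr := hasSubst_restrict (normSq_mem_orderIdeal (n := n))
  rw [linHol, Sum.elim_inl, restrict, subst_finset_sum hr, linZ]
  refine Finset.sum_congr rfl fun j _ => ?_
  rw [subst_smul hr, subst_X hr]
  rfl

theorem restrict_linHol_inr (N : Matrix (Fin n) (Fin n) ℂ) (δ : ℂ) (k : Unit) :
    restrict (normSq n) (linHol N δ (Sum.inr k)) = C δ * normSq n := by
  rw [linHol, Sum.elim_inr, restrict_mul normSq_mem_orderIdeal, restrict_C]
  congr 1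
  exact subst_X (hasSubst_restrict normSq_mem_orderIdeal) _

/-- If the substitution `z ↦ N z` takes `Φ` to `δ |z|²` up to terms of order three, then it takes
the restriction of `Q` to `w = Φ` to the restriction of `Q(N z, δ w)` to `w = |z|²`, up to terms of
higher order. -/
theorem subst_linZ_restrict_sub_mem {Φ : RealSeries n} (hΦ : Φ ∈ orderIdeal 1 2)
    {N : Matrix (Fin n) (Fin n) ℂ} {δ : ℂ}
    (hN : subst (elimConj (linZ N)) Φ - C δ * normSq n ∈ orderIdeal 1 3) {Q : HolSeries n} {t : ℕ}
    (hQ : Q ∈ orderIdeal (holWeight n) t) :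
    subst (elimConj (linZ N)) (restrict Φ Q) - restrict (normSq n) (subst (linHol N δ) Q) ∈
      orderIdeal 1 (t + 1) := by
  have hr := hasSubst_restrict (normSq_mem_orderIdeal (n := n))
  have hl := hasSubst_restrict hΦ
  have hdiff : ∀ s, subst (elimConj (linZ N)) (Sum.elim zVar (fun _ => Φ) s) -
      restrict (normSq n) (linHol N δ s) ∈ orderIdeal 1 (holWeight n s + 1) := by
    rintro (k | k)
    · rw [Sum.elim_inl, subst_linZ_zVar, restrict_linHol_inl, sub_self]
      exact zero_mem _
    · rw [Sum.elim_inr, restrict_linHol_inr]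
      exact hN
  have hmem : ∀ s, subst (elimConj (linZ N)) (Sum.elim zVar (fun _ => Φ) s : RealSeries n) ∈
      orderIdeal 1 (holWeight n s) := fun s => subst_linZ_mem N (elim_zVar_mem hΦ s)
  have h1 : subst (elimConj (linZ N)) (restrict Φ Q) =
      subst (fun s => subst (elimConj (linZ N)) (Sum.elim zVar (fun _ => Φ) s)) Q :=
    subst_comp_subst_apply hl (hasSubst_linZ N) Q
  have h2 : restrict (normSq n) (subst (linHol N δ) Q) =
      subst (fun s => restrict (normSq n) (linHol N δ s)) Q :=
    subst_comp_subst_apply (hasSubst_linHol N δ) hr Q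
  rw [h1, h2]
  have hc1 := hl.comp (hasSubst_linZ N)
  have hc2 := (hasSubst_linHol N δ).comp hr
  simp only [coe_substAlgHom] at hc1 hc2
  refine subst_sub_subst_mem_orderIdeal hc1 hc2 hmem (fun s => ?_) hdiff hQ
  have := sub_mem (hmem s) (orderIdeal_mono (Nat.le_succ _) (hdiff s))
  rwa [sub_sub_cancel] at this

/-- If `F = A z + ⋯` and `A N = 1`, then substituting `(F, F̄)` and then `z ↦ N z` does not change
the leading part. -/
theorem subst_linZ_subst_sub_mem {F : Fin n → RealSeries n} {A N : Matrix (Fin n) (Fin n) ℂ}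
    (hF : ∀ k, F k ∈ orderIdeal 1 1) (hFA : ∀ k, F k - linZ A k ∈ orderIdeal 1 2)
    (hAN : A * N = 1) {f : RealSeries n} {t : ℕ} (hf : f ∈ orderIdeal 1 t) :
    subst (elimConj (linZ N)) (subst (elimConj F) f) - f ∈ orderIdeal 1 (t + 1) := by
  have h1 : ∀ k, subst (elimConj (linZ N)) (F k) - zVar k ∈ orderIdeal 1 2 := fun k => by
    have := subst_linZ_mem N (hFA k)
    rwa [subst_sub (hasSubst_linZ N), subst_linZ_linZ hAN] at this
  have := subst_elimConj_sub_mem (e := 1) (fun k => subst_linZ_mem N (hF k)) zVar_mem h1 hf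
  rwa [elimConj_zVar, subst_self, id, ← subst_subst_elimConj hF (linZ_mem N)] at this

/-- If `G = d w + ⋯` restricts on `w = Φ` to `|F|² + ⋯` with `F = A z + ⋯` and `A N = 1`, then
the substitution `z ↦ N z` takes `Φ` to `d⁻¹ |z|²` up to terms of order three. -/
theorem subst_linZ_sub_inv_mul_normSq_mem {Φ φ : RealSeries n} (hΦ : Φ ∈ orderIdeal 1 2)
    (hφ : φ ∈ orderIdeal 1 3) {F : Fin n → RealSeries n} {A N : Matrix (Fin n) (Fin n) ℂ}
    (hF : ∀ k, F k ∈ orderIdeal 1 1) (hFA : ∀ k, F k - linZ A k ∈ orderIdeal 1 2)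
    (hAN : A * N = 1) {G : HolSeries n} {d : ℂ} (hd : d ≠ 0)
    (hG : G - C d * X (Sum.inr ()) ∈ orderIdeal (holWeight n) 3)
    (hmap : restrict Φ G = subst (elimConj F) (normSq n + φ)) :
    subst (elimConj (linZ N)) Φ - C d⁻¹ * normSq n ∈ orderIdeal 1 3 := by
  -- Up to order three the mapping equation reads `d Φ = |A z|²`; putting `N z` for `z` turns the
  -- right side into `|z|²`.
  have h1 : restrict Φ G - C d * Φ ∈ orderIdeal 1 3 := by
    have := restrict_mem_orderIdeal hΦ hG
    rw [restrict_sub hΦ, restrict_mul hΦ, restrict_C] at this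
    have hX : restrict Φ (X (Sum.inr ())) = Φ := subst_X (hasSubst_restrict hΦ) _
    rwa [hX] at this
  have h2 : subst (elimConj (linZ N)) (restrict Φ G) - normSq n ∈ orderIdeal 1 3 := by
    have := add_mem (subst_linZ_subst_sub_mem hF hFA hAN (normSq_add_mem hφ)) hφ
    rw [← hmap] at this
    convert this using 1
    ring
  have h3 := subst_linZ_mem N h1
  rw [subst_sub (hasSubst_linZ N), ← smul_eq_C_mul, subst_smul (hasSubst_linZ N),
    smul_eq_C_mul] at h3
  have h4 := Ideal.mul_mem_left _ (C d⁻¹) (sub_mem h2 h3)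
  have hCC : (C d⁻¹ * C d : RealSeries n) = 1 := by
    rw [← map_mul, inv_mul_cancel₀ hd, map_one]
  convert h4 using 1
  linear_combination -subst (elimConj (linZ N)) Φ * hCC

/-! ### Flatness of the pseudo-normal forms of a flattenable submanifold -/

theorem isRealValued_of_forall_mem {φ : RealSeries n}
    (h : ∀ t, 3 ≤ t → φ - conj φ ∈ orderIdeal 1 t) : IsRealValued φ :=
  (sub_eq_zero.1 (eq_zero_of_forall_mem_orderIdeal 3 h)).symm

theorem restrict_sub_sum_zVar_mem {Φ : RealSeries n} (hΦ : Φ ∈ orderIdeal 1 2) {h : HolSeries n}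
    (h0 : constantCoeff h = 0) :
    restrict Φ h - ∑ j, coeff (Finsupp.single (Sum.inl j) 1) h • zVar j ∈ orderIdeal 1 2 := by
  classical
  have h1 : h - ∑ j, coeff (Finsupp.single (Sum.inl j) 1) h • X (Sum.inl j) ∈
      orderIdeal (holWeight n) 2 := by
    rw [mem_orderIdeal_holWeight]
    intro I k hk
    obtain rfl : k = 0 := by omega
    rw [map_sub, map_sum, sub_eq_zero]
    simp only [coeff_smul, coeff_X]
    by_cases hI : I = 0
    · subst hI
      have hj : ∀ j : Fin n, (0 : Fin n ⊕ Unit →₀ ℕ) ≠ Finsupp.single (Sum.inl j) 1 := fun j h' =>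
        by simpa using DFunLike.congr_fun h' (Sum.inl j)
      simp [h0, hj]
    · obtain ⟨i, hi⟩ : ∃ i, I i ≠ 0 := by
        by_contra! hc
        exact hI (Finsupp.ext hc)
      have hle : Finsupp.single i 1 ≤ I := by rw [Finsupp.single_le_iff]; omega
      have hI1 : I = Finsupp.single i 1 := by
        have hdeg := congrArg Finsupp.degree (tsub_add_cancel_of_le hle)
        rw [map_add, Finsupp.degree_single] at hdeg
        have : (I - Finsupp.single i 1).degree = 0 := by omega
        rw [Finsupp.degree_eq_zero_iff] at this
        rw [← tsub_add_cancel_of_le hle, this, zero_add]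
      subst hI1
      rw [Finset.sum_eq_single i]
      · simp [holIndex]
      · intro j _ hj
        rw [if_neg, mul_zero]
        intro h'
        have := DFunLike.congr_fun h' (Sum.inl i)
        simp [holIndex, hj] at this
      · simp
  have h2 := restrict_mem_orderIdeal hΦ h1
  rw [restrict_sub hΦ] at h2
  convert h2 using 2
  rw [restrict, subst_finset_sum (hasSubst_restrict hΦ)]
  refine Finset.sum_congr rfl fun j _ => ?_
  rw [subst_smul (hasSubst_restrict hΦ), subst_X (hasSubst_restrict hΦ)]
  rfl

theorem det_ne_zero_of_isFormalChange {H : FormalMap n} (hH : IsFormalChange H) {d : ℂ}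
    (hd : H (Sum.inr ()) - C d * X (Sum.inr ()) ∈ orderIdeal (holWeight n) 3) :
    d ≠ 0 ∧ IsUnit (Matrix.det (Matrix.of fun i j : Fin n =>
      coeff (Finsupp.single (Sum.inl j) 1) (H (Sum.inl i)))) := by
  classical
  have hg : ∀ b, coeff (Finsupp.single b 1) (H (Sum.inr ())) =
      d * coeff (Finsupp.single b 1) (X (Sum.inr ()) : HolSeries n) := fun b => by
    have := hd (Finsupp.single b 1)
      (by rcases b with b | b <;> simp [Finsupp.weight_single, holWeight])
    rwa [map_sub, coeff_C_mul, sub_eq_zero] at this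
  have h1 : (Matrix.of fun a b : Fin n ⊕ Unit => coeff (Finsupp.single b 1) (H a)) =
      Matrix.fromBlocks (Matrix.of fun i j : Fin n =>
        coeff (Finsupp.single (Sum.inl j) 1) (H (Sum.inl i)))
        (Matrix.of fun i _ => coeff (Finsupp.single (Sum.inr ()) 1) (H (Sum.inl i)))
        0 (Matrix.of fun _ _ => d) := by
    ext a b
    rcases a with a | a <;> rcases b with b | b <;> simp [hg, coeff_index_single_X]
  have h2 := hH.2
  rw [h1, Matrix.det_fromBlocks_zero₂₁, IsUnit.mul_iff] at h2
  refine ⟨?_, h2.1⟩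
  have := h2.2.ne_zero
  simpa using this

section

variable [NeZero n]

theorem expCoeff_restrict_sub_conj (Q : HolSeries n) {I J : Fin n →₀ ℕ}
    (hIJ : ∀ k, I k * J k = 0) :
    expCoeff (restrict (normSq n) Q - conj (restrict (normSq n) Q)) I J =
      (if J = 0 then holCoeff Q I else 0) -
        MvPowerSeries.map (starRingEnd ℂ) (if I = 0 then holCoeff Q J else 0) := by
  rw [expCoeff_sub, expCoeff_conj, expCoeff_restrict_normSq _ hIJ,
    expCoeff_restrict_normSq _ fun k => by rw [mul_comm]; exact hIJ k]

/-- For `I ≠ 0` the terms `z^I u^k` and `z̄^I u^k` are independent in the expansion, so no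
cancellation with the conjugate is possible. Only real multiples of `u^k` survive. -/
theorem coeff_eq_of_restrict_sub_conj_mem {Q : HolSeries n} {t : ℕ}
    (h : restrict (normSq n) Q - conj (restrict (normSq n) Q) ∈ orderIdeal 1 (t + 1)) :
    (∀ I k, I.degree + 2 * k = t → I ≠ 0 → coeff (holIndex I k) Q = 0) ∧
    (∀ k, 2 * k = t → starRingEnd ℂ (coeff (holIndex 0 k) Q) = coeff (holIndex 0 k) Q) := by
  have key : ∀ I k, I.degree + 2 * k = t → coeff (k • e 0)
      (expCoeff (restrict (normSq n) Q - conj (restrict (normSq n) Q)) I 0) = 0 := fun I k hk =>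
    coeff_expCoeff_eq_zero h (by simp; omega)
  constructor
  · intro I k hk hI
    have := key I k hk
    rw [expCoeff_restrict_sub_conj _ (by simp), if_pos rfl, if_neg hI, map_zero, sub_zero,
      coeff_holCoeff] at this
    exact this
  · intro k hk
    have := key 0 k (by simpa using hk)
    rw [expCoeff_restrict_sub_conj _ (by simp), if_pos rfl, map_sub, coeff_map,
      coeff_holCoeff, sub_eq_zero] at this
    exact this.symm

/-- Reality on `M` in degree 1 excludes terms linear in `z`. In degree 2 it excludes terms quadratic
in `z` and makes the coefficient of `w` real. -/
theorem exists_sub_mul_X_mem {Φ : RealSeries n} (hΦ : Φ ∈ orderIdeal 1 2)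
    (hΦ' : Φ - normSq n ∈ orderIdeal 1 3) {G : HolSeries n} (hG0 : constantCoeff G = 0)
    (h : restrict Φ G - conj (restrict Φ G) ∈ orderIdeal 1 3) :
    ∃ d : ℝ, G - C (d : ℂ) * X (Sum.inr ()) ∈ orderIdeal (holWeight n) 3 := by
  have hX : (X (Sum.inr ()) : HolSeries n) - C ((1 : ℝ) : ℂ) * X (Sum.inr ()) ∈
      orderIdeal (holWeight n) 3 := by simp
  have h1 : G ∈ orderIdeal (holWeight n) 1 := by
    rw [mem_orderIdeal_holWeight]
    intro I k hk
    obtain rfl : k = 0 := by omega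
    obtain rfl : I = 0 := by
      rw [← Finsupp.degree_eq_zero_iff]; omega
    simpa using hG0
  have h2 : G ∈ orderIdeal (holWeight n) 2 := by
    have hc := (coeff_eq_of_restrict_sub_conj_mem
      (restrict_normSq_sub_conj_mem hΦ hΦ' h1 (orderIdeal_mono (by norm_num) h))).1
    rw [mem_orderIdeal_holWeight]
    intro I k hk
    rcases Nat.lt_or_ge (I.degree + 2 * k) 1 with h' | h'
    · exact mem_orderIdeal_holWeight.1 h1 _ _ h'
    · refine hc I k (by omega) ?_
      rintro rfl
      simp at hk h'; omega
  obtain ⟨hc, hr⟩ := coeff_eq_of_restrict_sub_conj_mem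
    (restrict_normSq_sub_conj_mem hΦ hΦ' h2 h)
  obtain ⟨a, ha⟩ := exists_sub_mul_pow_mem one_ne_zero hX h2 hc hr
  exact ⟨a, by simpa using ha⟩

/-- If `D` is twice the imaginary part of a normalized series and if its leading part is twice the
imaginary part of a series in `z` and `u`, then this leading part vanishes. -/
theorem mem_orderIdeal_succ_of_normalized {φ : RealSeries n} (hφ : IsNormalized φ) {t : ℕ}
    (ht : 3 ≤ t) (hD : φ - conj φ ∈ orderIdeal 1 t) {q : HolSeries n}
    (hq : φ - conj φ - (restrict (normSq n) q - conj (restrict (normSq n) q)) ∈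
      orderIdeal 1 (t + 1)) : φ - conj φ ∈ orderIdeal 1 (t + 1) := by
  obtain ⟨-, c, hc, hn⟩ := hφ
  -- These are the coefficients that `q` could influence. Since `t ≥ 3`, either `I = 0` and `k ≥ 2`,
  -- or `I ≠ 0` and `k ≥ 1`, or `k = 0` and `|I| > 2`, and the normalization covers each case.
  have hcD : ∀ I k, I.degree + 2 * k = t → uvCoeff (φ - conj φ) I 0 (k • e 0) = 0 := by
    intro I k hk
    rw [uvCoeff, expCoeff_sub, expCoeff_conj, map_sub, coeff_map, ← hc.eq_coeff (by simp),
      ← hc.eq_coeff (by simp)]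
    by_cases hI : I = 0
    · subst hI
      rw [hn.pure_u k (by simp at hk; omega)]
      simp
    · have hdeg : 1 ≤ I.degree := by
        rw [Nat.one_le_iff_ne_zero, Ne, Finsupp.degree_eq_zero_iff]; exact hI
      by_cases hk0 : k = 0
      · subst hk0
        rw [zero_smul, hn.harmonic I (by omega), Complex.conj_conj, sub_self]
      · rw [hn.hol_u k (by omega) I hdeg, hn.antihol_u k (by omega) I hdeg]
        simp
  have hcoeff : ∀ I K : Fin n →₀ ℕ, I.degree + 2 * K.degree = t →
      uvCoeff (φ - conj φ) I 0 K = 0 := by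
    intro I K hK
    by_cases hK' : K = Finsupp.single 0 (K 0)
    · have : K = K 0 • e 0 := by simpa using hK'
      rw [this]
      refine hcD I _ ?_
      rw [this] at hK
      simpa using hK
    -- If `K` is not a multiple of `e 0`, then `q` contributes nothing, as it brings in only powers
    -- of `u`.
    · rw [uvCoeff_congr hq (by simp; omega), uvCoeff,
        expCoeff_restrict_sub_conj _ (by simp), if_pos rfl, map_sub, coeff_map]
      split_ifs <;> simp [holCoeff, uSeries, hK']
  refine mem_orderIdeal_of_expCoeff fun I J hIJ K hK => ?_
  rcases Nat.lt_or_ge (I.degree + J.degree + 2 * K.degree) t with h | h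
  · exact coeff_expCoeff_eq_zero hD h
  by_cases hJ : J = 0
  · subst hJ
    exact hcoeff I K (by simp at h hK; omega)
  by_cases hI : I = 0
  · subst hI
    -- The case `I = 0` follows from `J = 0`, because `φ - φ̄` changes sign under conjugation.
    have h1 : coeff K (expCoeff (φ - conj φ) J 0) = 0 := hcoeff J K (by simp at h hK; omega)
    have h2 : conj (φ - conj φ) = -(φ - conj φ) := by rw [conj_sub, conj_conj]; ring
    have h3 : φ - conj φ = 0 - conj (φ - conj φ) := by rw [h2]; ring
    rw [h3, expCoeff_sub, expCoeff_conj, expCoeff_zero, map_sub, coeff_map, h1]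
    simp
  · change uvCoeff _ _ _ _ = 0
    rw [uvCoeff_congr hq hK, uvCoeff, expCoeff_restrict_sub_conj _ hIJ, if_neg hI, if_neg hJ]
    simp

/-- A normalized series `φ` is real-valued if `w = Φ` maps to `w = |z|² + φ` and admits a
holomorphic function with nondegenerate linear part whose restriction is real-valued. -/
theorem isRealValued_of_mapsGraph {Φ φ : RealSeries n} (hΦ : Φ ∈ orderIdeal 1 2)
    (hΦ' : Φ - normSq n ∈ orderIdeal 1 3) (hφ : IsNormalized φ) {H₁ H₂ : FormalMap n}
    (hH₁ : IsFormalChange H₁) (hreal : IsRealValued (restrict Φ (H₁ (Sum.inr ()))))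
    (hH₂ : IsFormalChange H₂) (hmap : MapsGraph H₂ Φ (normSq n + φ)) : IsRealValued φ := by
  have hφ3 : φ ∈ orderIdeal 1 3 := mem_orderIdeal_one_iff_le.2 hφ.1
  have hD3 : φ - conj φ ∈ orderIdeal 1 3 := sub_mem hφ3 (conj_mem_orderIdeal hφ3)
  set F : Fin n → RealSeries n := fun k => restrict Φ (H₂ (Sum.inl k)) with hF
  have hFlin := fun k => restrict_sub_sum_zVar_mem hΦ (hH₂.1 (Sum.inl k))
  have hF1 : ∀ k, F k ∈ orderIdeal 1 1 := fun k => by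
    have := add_mem (orderIdeal_mono (by norm_num) (hFlin k))
      (linZ_mem (Matrix.of fun i j => coeff (Finsupp.single (Sum.inl j) 1) (H₂ (Sum.inl i))) k)
    exact (sub_add_cancel (F k) _) ▸ this
  have hmap' : restrict Φ (H₂ (Sum.inr ())) = subst (elimConj F) (normSq n + φ) := hmap
  have hGD : restrict Φ (H₂ (Sum.inr ())) - conj (restrict Φ (H₂ (Sum.inr ()))) =
      subst (elimConj F) (φ - conj φ) := by
    rw [hmap', conj_subst_elimConj hF1, ← subst_sub (hasSubst_elimConj hF1), conj_add,
      conj_normSq]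
    congr 1
    ring
  have hsubstF : ∀ {f : RealSeries n} {t : ℕ}, f ∈ orderIdeal 1 t →
      subst (elimConj F) f ∈ orderIdeal 1 t := fun hf =>
    subst_mem_orderIdeal (w := 1) (hasSubst_elimConj hF1) (elimConj_mem hF1) hf
  obtain ⟨d₁, hd₁⟩ := exists_sub_mul_X_mem hΦ hΦ' (hH₁.1 (Sum.inr ())) (by
    rw [IsRealValued] at hreal
    rw [hreal, sub_self]
    exact zero_mem _)
  obtain ⟨d₂, hd₂⟩ := exists_sub_mul_X_mem hΦ hΦ' (hH₂.1 (Sum.inr ())) (by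
    rw [hGD]
    exact hsubstF hD3)
  have hd₁0 : d₁ ≠ 0 := by exact_mod_cast (det_ne_zero_of_isFormalChange hH₁ hd₁).1
  obtain ⟨hd₂0, hA⟩ := det_ne_zero_of_isFormalChange hH₂ hd₂
  set A : Matrix (Fin n) (Fin n) ℂ := Matrix.of fun i j =>
    coeff (Finsupp.single (Sum.inl j) 1) (H₂ (Sum.inl i)) with hAdef
  have hAN : A * A⁻¹ = 1 := Matrix.mul_nonsing_inv _ hA
  have hFA : ∀ k, F k - linZ A k ∈ orderIdeal 1 2 := hFlin
  have hSΦ := subst_linZ_sub_inv_mul_normSq_mem hΦ hφ3 hF1 hFA hAN hd₂0 hd₂ hmap'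
  have main : ∀ t, φ - conj φ ∈ orderIdeal 1 (t + 3) ∧ ∃ P : HolSeries n,
      IsRealValued (restrict Φ P) ∧ H₂ (Sum.inr ()) - P ∈ orderIdeal (holWeight n) (t + 3) := by
    intro t
    induction t with
    | zero =>
      -- Start with `P = (d₂ / d₁) G₁`, which matches the term `d₂ w` of `G₂`.
      refine ⟨hD3, _, isRealValued_restrict_add_mul_pow hΦ (P := 0) ?_ hreal (d₂ / d₁) 1, ?_⟩
      · rw [restrict_zero _ hΦ, IsRealValued, conj_zero]
      · have := sub_mem hd₂ (Ideal.mul_mem_left _ (C ((d₂ / d₁ : ℝ) : ℂ)) hd₁)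
        have hCC : (C ((d₂ / d₁ : ℝ) : ℂ) * C (d₁ : ℂ) : HolSeries n) = C (d₂ : ℂ) := by
          rw [← map_mul, ← Complex.ofReal_mul, div_mul_cancel₀ _ hd₁0]
        convert this using 1
        linear_combination -X (Sum.inr ()) * hCC
    | succ t ih =>
      obtain ⟨hDt, P, hP, hQ⟩ := ih
      have hQD : restrict Φ (H₂ (Sum.inr ()) - P) - conj (restrict Φ (H₂ (Sum.inr ()) - P)) =
          subst (elimConj F) (φ - conj φ) := by
        rw [IsRealValued] at hP
        rw [← hGD, restrict_sub hΦ, conj_sub, hP]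
        ring
      have hDt' : φ - conj φ ∈ orderIdeal 1 (t + 3 + 1) := by
        refine mem_orderIdeal_succ_of_normalized hφ (by omega) hDt
          -- Under `z ↦ A⁻¹ z` the series `Φ` becomes `d₂⁻¹ |z|²` to leading order, so `Q` restricts
          -- to `Q(A⁻¹ z, d₂⁻¹ u)`. The same substitution undoes the linear part of `F` in `φ(F,
          -- F̄)`.
          (q := subst (linHol A⁻¹ (d₂ : ℂ)⁻¹) (H₂ (Sum.inr ()) - P)) ?_
        have h1 := subst_linZ_subst_sub_mem hF1 hFA hAN hDt
        have h2 := subst_linZ_restrict_sub_mem hΦ hSΦ hQ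
        have h3 := conj_mem_orderIdeal h2
        rw [conj_sub, conj_subst_elimConj (linZ_mem _)] at h3
        rw [← hQD, subst_sub (hasSubst_linZ _)] at h1
        have := sub_mem (sub_mem h2 h3) h1
        convert this using 1
        ring
      -- With the improved order of `φ - φ̄`, the restriction of `Q` to `M` is real to leading
      -- order, and `P` can be corrected by a real multiple of a power of `G₁`.
      have hQreal := hsubstF hDt'
      rw [← hQD] at hQreal
      obtain ⟨hc, hr⟩ := coeff_eq_of_restrict_sub_conj_mem
        (restrict_normSq_sub_conj_mem hΦ hΦ' hQ hQreal)
      obtain ⟨a, ha⟩ := exists_sub_mul_pow_mem hd₁0 hd₁ hQ hc hr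
      refine ⟨hDt', _, isRealValued_restrict_add_mul_pow hΦ hP hreal a ((t + 3) / 2), ?_⟩
      rwa [← sub_sub]
  refine isRealValued_of_forall_mem fun t ht => ?_
  obtain ⟨s, rfl⟩ : ∃ s, t = s + 3 := ⟨t - 3, by omega⟩
  exact (main s).1

theorem isRealValued_of_canBeFlattened {E φ : RealSeries n} (hE : E ∈ orderIdeal 1 3)
    (hflat : CanBeFlattened (normSq n + E)) (hφ : IsPseudoNormalForm E φ) : IsRealValued φ := by
  obtain ⟨Estar, hreal, H₁, hH₁, hmap₁⟩ := hflat
  obtain ⟨hn, H₂, hH₂, hmap₂⟩ := hφ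
  have hΦ := normSq_add_mem hE
  refine isRealValued_of_mapsGraph hΦ (by simpa using hE) hn hH₁ ?_ hH₂ hmap₂
  rw [MapsGraph] at hmap₁
  -- On `M` the `w`-component of the flattening equals `E*(F, F̄)`, which is real-valued along with
  -- `E*`.
  rw [IsRealValued, hmap₁, conj_subst_elim, hreal]
  intro k
  refine mem_orderIdeal_one_one.1 (restrict_mem_orderIdeal hΦ ?_)
  rw [mem_orderIdeal_holWeight]
  intro I j hj
  obtain rfl : j = 0 := by omega
  obtain rfl : I = 0 := by
    rw [← Finsupp.degree_eq_zero_iff]; omega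
  simpa using hH₁.1 (Sum.inl k)

end

end CRSingular

theorem theorem3p5 (n : ℕ) [NeZero n] (hn : 2 ≤ n) (E : CRSingular.RealSeries n)
    (hE : 3 ≤ E.order) :
    List.TFAE
      [CRSingular.CanBeFlattened (CRSingular.normSq n + E),
        ∃ φ : CRSingular.RealSeries n,
          CRSingular.IsPseudoNormalForm E φ ∧ CRSingular.IsRealValued φ,
        ∀ φ : CRSingular.RealSeries n,
          CRSingular.IsPseudoNormalForm E φ → CRSingular.IsRealValued φ] := by
  have hE' : E ∈ orderIdeal 1 3 := mem_orderIdeal_one_iff_le.2 hE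
  tfae_have 1 → 3 := fun h φ hφ => CRSingular.isRealValued_of_canBeFlattened hE' h hφ
  tfae_have 3 → 2 := fun h => by
    obtain ⟨φ, hφ⟩ := CRSingular.exists_isPseudoNormalForm hE'
    exact ⟨φ, hφ, h φ hφ⟩
  tfae_have 2 → 1 := by
    rintro ⟨φ, hφ, hreal⟩
    refine ⟨CRSingular.normSq n + φ, ?_, hφ.2⟩
    rw [CRSingular.IsRealValued, CRSingular.conj_add, CRSingular.conj_normSq, hreal]
  tfae_finish
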